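/- Let $(M,g)$ be a three-dimensional compact smooth Riemannian manifold with boundary, let $\ell>0$, and let $\gamma:[0,\ell]\to M$ be a unit-speed geodesic (for instance a maximal geodesic, with $\gamma(0),\gamma(\ell)\in\partial M$) without conjugate points; precisely, no point $\gamma(s)$, $0<s<\ell$, is conjugate along $\gamma$ to a point $\gamma(t)$ with $t\in[0,\ell]$, $t\ne s$. Let $e_1,e_2$ be a parallel orthonormal frame of $\dot\gamma^{\perp}$ along $\gamma$, let $K(t)$ be the symmetric $2\times2$ matrix $K_{ab}=\langle R(e_b,\dot\gamma)\dot\gamma,e_a\rangle_g$, where $R$ is the Riemann curvature tensor with the sign for which $K$ is positive on the round sphere, and for a complex symmetric $2\times 2$ matrix $H_0$ with $\operatorname{Im}H_0>0$ let $\widetilde Y=\widetilde Y_{H_0}:[0,\ell]\to\mathbb C^{2\times2}$ be the solution of the complex Jacobi equation $$\ddot{\widetilde Y}+K\widetilde Y=0,\qquad \widetilde Y(0)=I,\quad \dot{\widetilde Y}(0)=H_0 .$$ Let $m\ge1$ be an integer and let $f:M\to\mathbb C$ be continuous. If $$\mathcal J^{(m)}_{\widetilde Y}f:=\int_0^{\ell}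 f(\gamma(t))\,\bigl|\det\widetilde Y(t)\bigr|^{-1}\bigl(\det\widetilde Y(t)\bigr)^{-m/2}\,dt=0$$ for every such $H_0$, then $f(\gamma(t))=0$ for all $t\in[0,\ell]$. Here $(\det\widetilde Y)^{-m/2}=\sigma^{-m}$ for a continuous branch $\sigma$ of $(\det\widetilde Y)^{1/2}$ along $[0,\ell]$; such a branch is unique up to sign, so that the hypothesis does not depend on the choice. -/

import Mathlib

set_option maxSynthPendingDepth 3

open scoped Manifold ContDiff

noncomputable section

namespace RayTransform

/-! ### A metric in local coordinates

`G y` is the inner product at the point `y` of a subset `S` of `ℝ³` (the range of a chart of a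
manifold with boundary is relatively open in a half space, so one-sided derivatives are used). -/

/-- Coordinate space `ℝ³`. -/
abbrev E3 := EuclideanSpace ℝ (Fin 3)

/-- Continuous bilinear forms on `ℝ³`. -/
abbrev Bil := E3 →L[ℝ] E3 →L[ℝ] ℝ

/-- Christoffel symbols of the first kind, as a trilinear expression:
`½ (∂_u G(v, w) + ∂_v G(u, w) - ∂_w G(u, v))` at `y`, for constant vectors `u, v, w`. -/
def christoffelFirst (S : Set E3) (G : E3 → Bil) (y u v w : E3) : ℝ :=
  (1 / 2 : ℝ) * (fderivWithin ℝ G S y u v w + fderivWithin ℝ G S y v u w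
    - fderivWithin ℝ G S y w u v)

/-- The standard basis of `ℝ³`. -/
def stdVec (i : Fin 3) : E3 := EuclideanSpace.single i (1 : ℝ)

/-- The Gram matrix `G_{ij}` at `y`. -/
def gram (G : E3 → Bil) (y : E3) : Matrix (Fin 3) (Fin 3) ℝ :=
  Matrix.of fun i j => G y (stdVec i) (stdVec j)

/-- Christoffel symbols of the second kind: the vector `Γ(u, v)` with components
`Γ^k_{ij} u^i v^j = ∑ₗ G^{kl} Γ_{ij,l} u^i v^j`. -/
def christoffel (S : Set E3) (G : E3 → Bil) (y u v : E3) : E3 :=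
  WithLp.toLp 2 fun k => ∑ l, (gram G y)⁻¹ k l * christoffelFirst S G y u v (stdVec l)

/-- Second derivative `∂_u ∂_v G(a, b)` at `y`, for constant vectors `u, v, a, b`. -/
def hessMetric (S : Set E3) (G : E3 → Bil) (y u v a b : E3) : ℝ :=
  fderivWithin ℝ (fderivWithin ℝ G S) S y u v a b

/-- The Riemann curvature tensor with lowered indices in coordinates,
`R_{ikℓm} = ½ (∂_k∂_ℓ G_{im} + ∂_i∂_m G_{kℓ} - ∂_k∂_m G_{iℓ} - ∂_i∂_ℓ G_{km})
  + G_{np} (Γ^n_{kℓ} Γ^p_{im} - Γ^n_{km} Γ^p_{iℓ})`,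
contracted with `aⁱ bᵏ c^ℓ d^m`. Thus `riemann a b c d = ⟨R(c, d) b, a⟩` with
`R(X, Y) = ∇_X ∇_Y - ∇_Y ∇_X - ∇_[X,Y]`, and `riemann a b a b` is the sectional curvature for
orthonormal `a, b`. -/
def riemann (S : Set E3) (G : E3 → Bil) (y a b c d : E3) : ℝ :=
  (1 / 2 : ℝ) * (hessMetric S G y b c a d + hessMetric S G y a d b c
    - hessMetric S G y b d a c - hessMetric S G y a c b d)
  + G y (christoffel S G y b c) (christoffel S G y a d)
  - G y (christoffel S G y b d) (christoffel S G y a c)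

/-! ### Riemannian 3-manifolds with boundary -/

section Manifold

variable {M : Type*} [TopologicalSpace M] [ChartedSpace (EuclideanHalfSpace 3) M]
  [IsManifold (𝓡∂ 3) ∞ M]

/-- Smooth Riemannian metrics on `M`. -/
abbrev Metric (M : Type*) [TopologicalSpace M] [ChartedSpace (EuclideanHalfSpace 3) M]
    [IsManifold (𝓡∂ 3) ∞ M] :=
  Bundle.ContMDiffRiemannianMetric (𝓡∂ 3) ∞ E3 (fun p : M => TangentSpace (𝓡∂ 3) p)

/-- Components, in the chart around `x`, of the tangent vector `V` at the point `p`. -/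
def chartVec (x p : M) (V : TangentSpace (𝓡∂ 3) p) : E3 :=
  tangentCoordChange (𝓡∂ 3) p x p V

/-- The inner product on `T_p M`, as a bilinear form on `ℝ³` (the model of `T_p M`). -/
def metricAt (g : Metric M) (p : M) : Bil := g.inner p

/-- The metric in the chart around `x`, as a function of the coordinate `y`: the vector with
components `u` in this chart is `tangentCoordChange x p p u` in `T_p M`. -/
def metricInChart (g : Metric M) (x : M) (y : E3) : Bil :=
  let p : M := (extChartAt (𝓡∂ 3) x).symm y
  (metricAt g p).bilinearComp (tangentCoordChange (𝓡∂ 3) x p p) (tangentCoordChange (𝓡∂ 3) x p p)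

/-- `Γ(u, v)` at the point `p`, in the chart around `p` (through which Mathlib identifies `T_p M`
with `ℝ³`). -/
def christoffelAt (g : Metric M) (p : M) (u v : TangentSpace (𝓡∂ 3) p) : TangentSpace (𝓡∂ 3) p :=
  christoffel (Set.range (𝓡∂ 3)) (metricInChart g p) (extChartAt (𝓡∂ 3) p p) u v

/-- The Riemann curvature tensor `⟨R(c, d) b, a⟩` on `T_p M`. -/
def riemannAt (g : Metric M) (p : M) (a b c d : TangentSpace (𝓡∂ 3) p) : ℝ :=
  riemann (Set.range (𝓡∂ 3)) (metricInChart g p) (extChartAt (𝓡∂ 3) p p) a b c d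

/-! ### Vector fields along a curve `γ : [0, ℓ] → M` -/

/-- `v` is the velocity field of `γ` on `[0, ℓ]`. -/
def IsVelocity (ℓ : ℝ) (γ : ℝ → M) (v : (t : ℝ) → TangentSpace (𝓡∂ 3) (γ t)) : Prop :=
  ∀ t ∈ Set.Icc 0 ℓ, HasMFDerivWithinAt 𝓘(ℝ, ℝ) (𝓡∂ 3) γ (Set.Icc 0 ℓ) t
    ((1 : ℝ →L[ℝ] ℝ).smulRight (v t))

/-- The field `V` along `γ` (with velocity `v`) is differentiable on `[0, ℓ]` with covariant
derivative `W`: in the chart around `γ t` the components satisfy `V' + Γ(v, V) = W` at `t`. -/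
def HasCovDeriv (g : Metric M) (ℓ : ℝ) (γ : ℝ → M)
    (v V W : (t : ℝ) → TangentSpace (𝓡∂ 3) (γ t)) : Prop :=
  ∀ t ∈ Set.Icc 0 ℓ,
    HasDerivWithinAt (fun s => chartVec (γ t) (γ s) (V s))
      (chartVec (γ t) (γ t) (W t - christoffelAt g (γ t) (v t) (V t))) (Set.Icc 0 ℓ) t

/-- `γ : [0, ℓ] → M` is a unit speed geodesic with velocity field `v`. -/
structure IsUnitSpeedGeodesic (g : Metric M) (ℓ : ℝ) (γ : ℝ → M)
    (v : (t : ℝ) → TangentSpace (𝓡∂ 3) (γ t)) : Prop where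
  velocity : IsVelocity ℓ γ v
  geodesic : HasCovDeriv g ℓ γ v v (fun _ => 0)
  unit_speed : ∀ t ∈ Set.Icc 0 ℓ, g.inner (γ t) (v t) (v t) = 1

/-- `J` is a (real) Jacobi field along `γ`: `D_t² J + R(J, v) v = 0`. -/
def IsJacobiField (g : Metric M) (ℓ : ℝ) (γ : ℝ → M)
    (v J : (t : ℝ) → TangentSpace (𝓡∂ 3) (γ t)) : Prop :=
  ∃ W Z : (t : ℝ) → TangentSpace (𝓡∂ 3) (γ t),
    HasCovDeriv g ℓ γ v J W ∧ HasCovDeriv g ℓ γ v W Z ∧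
    ∀ t ∈ Set.Icc 0 ℓ, ∀ u : TangentSpace (𝓡∂ 3) (γ t),
      g.inner (γ t) (Z t) u + riemannAt g (γ t) u (v t) (J t) (v t) = 0

/-- `γ s` and `γ t` are conjugate along `γ`: some nontrivial Jacobi field vanishes at both. -/
def AreConjugate (g : Metric M) (ℓ : ℝ) (γ : ℝ → M)
    (v : (t : ℝ) → TangentSpace (𝓡∂ 3) (γ t)) (s t : ℝ) : Prop :=
  ∃ J : (t : ℝ) → TangentSpace (𝓡∂ 3) (γ t), IsJacobiField g ℓ γ v J ∧
    J s = 0 ∧ J t = 0 ∧ ∃ r ∈ Set.Icc 0 ℓ, J r ≠ 0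

/-- `e` is a parallel orthonormal frame of the normal bundle `v^⊥` along `γ`. -/
structure IsParallelNormalFrame (g : Metric M) (ℓ : ℝ) (γ : ℝ → M)
    (v : (t : ℝ) → TangentSpace (𝓡∂ 3) (γ t))
    (e : Fin 2 → (t : ℝ) → TangentSpace (𝓡∂ 3) (γ t)) : Prop where
  parallel : ∀ a, HasCovDeriv g ℓ γ v (e a) (fun _ => 0)
  orthonormal : ∀ t ∈ Set.Icc 0 ℓ, ∀ a b,
    g.inner (γ t) (e a t) (e b t) = if a = b then 1 else 0
  normal : ∀ t ∈ Set.Icc 0 ℓ, ∀ a, g.inner (γ t) (e a t) (v t) = 0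

/-- The matrix of the directional curvature operator `X ↦ R(X, v) v` on `v^⊥` in the frame `e`. -/
def curvMatrix (g : Metric M) (γ : ℝ → M) (v : (t : ℝ) → TangentSpace (𝓡∂ 3) (γ t))
    (e : Fin 2 → (t : ℝ) → TangentSpace (𝓡∂ 3) (γ t)) (t : ℝ) : Matrix (Fin 2) (Fin 2) ℝ :=
  Matrix.of fun a b => riemannAt g (γ t) (e a t) (v t) (e b t) (v t)

/-- `Y` solves the complex Jacobi equation `Y'' + K Y = 0` on `[0, ℓ]`, where `K` is the matrix of
`X ↦ R(X, v) v` in the frame `e`, with `Y(0) = I` and `Y'(0) = H₀`. -/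
def IsComplexJacobi (g : Metric M) (ℓ : ℝ) (γ : ℝ → M)
    (v : (t : ℝ) → TangentSpace (𝓡∂ 3) (γ t))
    (e : Fin 2 → (t : ℝ) → TangentSpace (𝓡∂ 3) (γ t))
    (H₀ : Matrix (Fin 2) (Fin 2) ℂ) (Y : ℝ → Matrix (Fin 2) (Fin 2) ℂ) : Prop :=
  ∃ Y' : ℝ → Matrix (Fin 2) (Fin 2) ℂ,
    (∀ t ∈ Set.Icc 0 ℓ, ∀ a b,
      HasDerivWithinAt (fun s => Y s a b) (Y' t a b) (Set.Icc 0 ℓ) t) ∧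
    (∀ t ∈ Set.Icc 0 ℓ, ∀ a b,
      HasDerivWithinAt (fun s => Y' s a b)
        (-(((curvMatrix g γ v e t).map ((↑) : ℝ → ℂ) * Y t) a b)) (Set.Icc 0 ℓ) t) ∧
    Y 0 = 1 ∧ Y' 0 = H₀

/-- `σ` is a continuous branch of `(det Y)^{1/2}` on `[0, ℓ]`. -/
def IsSqrtDet (ℓ : ℝ) (Y : ℝ → Matrix (Fin 2) (Fin 2) ℂ) (σ : ℝ → ℂ) : Prop :=
  ContinuousOn σ (Set.Icc 0 ℓ) ∧ ∀ t ∈ Set.Icc 0 ℓ, σ t ^ 2 = (Y t).det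

/-- The weighted ray transform `∫₀^ℓ f(γ(t)) |det Y(t)|⁻¹ (det Y(t))^{-m/2} dt`, where
`(det Y)^{-m/2} = σ^{-m}` for a branch `σ` of `(det Y)^{1/2}`. -/
def rayTransform (ℓ : ℝ) (γ : ℝ → M) (m : ℕ) (Y : ℝ → Matrix (Fin 2) (Fin 2) ℂ) (σ : ℝ → ℂ)
    (f : C(M, ℂ)) : ℂ :=
  ∫ t in (0 : ℝ)..ℓ, f (γ t) * ((‖(Y t).det‖⁻¹ : ℝ) : ℂ) * (σ t ^ m)⁻¹

end Manifold

end RayTransform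

end

noncomputable section

namespace RayTransform

open Filter Topology Set MeasureTheory

/-! ### Tensoriality of the curvature expression -/

/-! Fix an interior time `t₀`. Let `C`, `D` be the real matrix Jacobi solutions with `C = I, C' = 0`
and `D = 0, D' = I` at `t₀`, and put `Z = D - iεC` with `ε > 0`. Constancy of the Wronskians makes
`Z'Z⁻¹` symmetric with imaginary part `ε Z⁻ᴴ Z⁻¹ > 0`, so `Y(t) = Z(t) Z(0)⁻¹` is admissible: its
initial derivative is one of the matrices `H₀` in the hypothesis.

As `ε → 0` the weight of this `Y` concentrates at `t₀`. Write `D = (t - t₀) X` and `w = iε / (t - t₀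
- iε)`. Then `Z = (t - t₀ - iε)(X - w(C - X))`, hence `det Z = (t - t₀ - iε)² (det X - w b + w² p)`,
where `b` and `p` vanish at `t₀` because `X(t₀) = C(t₀) = I`. Absence of points conjugate to `t₀`
says exactly that `det X` has no zero; it is therefore bounded below by a positive constant, and for
small `ε` the second factor stays in the right half plane. Its principal root `r` gives the branch
`σ = (t - t₀ - iε) r`.

After the substitution `t = t₀ + εs`, dominated convergence turns the vanishing integrals into
`f(γ(t₀)) ∫ (1 + s²)⁻¹ (s - i)⁻ᵐ ds = 0`. The integral is `(i/2)ᵐ π`, by a recursion in `m`, so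
`f(γ(t₀)) = 0`; the endpoints follow by continuity. The core is `det_complexCombination`,
`complexCombination_initial`, `eventually_re_perturbedDet` and `eq_zero_of_concentrating_weights`.

The geometric input is that the curvature matrix in the parallel frame is symmetric and continuous,
and that frame solutions are Jacobi fields. Continuity is not immediate: `riemannAt` at `p` is
computed in the preferred chart of `p`, which may jump along `γ`. The coordinate formula is
therefore shown to be tensorial (`riemann_pullback`), which allows one fixed chart near each time.
-/

lemma hasFDerivWithinAt_bil_apply {S : Set E3} {z : E3} {T : E3 → Bil} {T' : E3 →L[ℝ] Bil}
    {p q : E3 → E3} {p' q' : E3 →L[ℝ] E3} (hT : HasFDerivWithinAt T T' S z)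
    (hp : HasFDerivWithinAt p p' S z) (hq : HasFDerivWithinAt q q' S z) :
    ∃ L : E3 →L[ℝ] ℝ, HasFDerivWithinAt (fun x => T x (p x) (q x)) L S z ∧
      ∀ u, L u = T' u (p z) (q z) + T z (p' u) (q z) + T z (p z) (q' u) := by
  refine ⟨_, (hT.clm_apply hp).clm_apply hq, fun u => ?_⟩
  simp
  ring

lemma hasFDerivWithinAt_tri_apply {S : Set E3} {z : E3} {T : E3 → E3 →L[ℝ] Bil}
    {T' : E3 →L[ℝ] E3 →L[ℝ] Bil}
    {o p q : E3 → E3} {o' p' q' : E3 →L[ℝ] E3} (hT : HasFDerivWithinAt T T' S z)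
    (ho : HasFDerivWithinAt o o' S z)
    (hp : HasFDerivWithinAt p p' S z) (hq : HasFDerivWithinAt q q' S z) :
    ∃ L : E3 →L[ℝ] ℝ, HasFDerivWithinAt (fun x => T x (o x) (p x) (q x)) L S z ∧
      ∀ u, L u = T' u (o z) (p z) (q z) + T z (o' u) (p z) (q z) + T z (o z) (p' u) (q z)
        + T z (o z) (p z) (q' u) := by
  refine ⟨_, ((hT.clm_apply ho).clm_apply hp).clm_apply hq, fun u => ?_⟩
  simp
  ring

lemma fderivWithin_bil_eval {S : Set E3} (hS : UniqueDiffOn ℝ S) {z : E3} (hz : z ∈ S)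
    {G : E3 → Bil} (hG : DifferentiableWithinAt ℝ G S z) {a b : E3} {L : E3 →L[ℝ] ℝ}
    (hL : HasFDerivWithinAt (fun x => G x a b) L S z) (u : E3) :
    fderivWithin ℝ G S z u a b = L u := by
  obtain ⟨L', h, h'⟩ := hasFDerivWithinAt_bil_apply hG.hasFDerivWithinAt
    (hasFDerivWithinAt_const a z S) (hasFDerivWithinAt_const b z S)
  have := (hS z hz).eq h hL
  rw [← this, h']
  simp

lemma hessMetric_eval {S : Set E3} (hS : UniqueDiffOn ℝ S) {z : E3} (hz : z ∈ S)
    {G : E3 → Bil} (hG : DifferentiableWithinAt ℝ (fderivWithin ℝ G S) S z) {v a b : E3}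
    {L : E3 →L[ℝ] ℝ}
    (hL : HasFDerivWithinAt (fun x => fderivWithin ℝ G S x v a b) L S z) (u : E3) :
    hessMetric S G z u v a b = L u := by
  obtain ⟨L', h, h'⟩ := hasFDerivWithinAt_tri_apply hG.hasFDerivWithinAt
    (hasFDerivWithinAt_const v z S)
    (hasFDerivWithinAt_const a z S) (hasFDerivWithinAt_const b z S)
  have := (hS z hz).eq h hL
  rw [← this, h', hessMetric]
  simp

lemma smooth_fderivWithin {F : Type*} [NormedAddCommGroup F] [NormedSpace ℝ F]
    {S : Set E3} (hS : UniqueDiffOn ℝ S) {y : E3} (hy : y ∈ S)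
    {f : E3 → F} (hf : ContDiffWithinAt ℝ ∞ f S y) :
    ContDiffWithinAt ℝ ∞ (fderivWithin ℝ f S) S y :=
  hf.fderivWithin_right hS (by simp) hy

lemma eventually_smooth {F : Type*} [NormedAddCommGroup F] [NormedSpace ℝ F]
    {S : Set E3} {y : E3} (hy : y ∈ S)
    {f : E3 → F} (hf : ContDiffWithinAt ℝ ∞ f S y) :
    ∀ᶠ z in 𝓝[S] y, ContDiffWithinAt ℝ 3 f S z := by
  have h3 : ContDiffWithinAt ℝ 3 f S y := hf.of_le ENat.LEInfty.out
  have := h3.eventually (by simp)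
  rwa [insert_eq_of_mem hy] at this

/-- The first derivative of the pullback of `G` by `φ`. -/
lemma fderivWithin_pullback {S : Set E3} (hS : UniqueDiffOn ℝ S)
    {G G' : E3 → Bil} {φ : E3 → E3} {z : E3} (hz : z ∈ S) (hmaps : MapsTo φ S S)
    (hφ : DifferentiableWithinAt ℝ φ S z)
    (hΦ : DifferentiableWithinAt ℝ (fderivWithin ℝ φ S) S z)
    (hG : DifferentiableWithinAt ℝ G S (φ z)) (hG' : DifferentiableWithinAt ℝ G' S z)
    (hpull : ∀ᶠ x in 𝓝[S] z, ∀ a b,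
      G' x a b = G (φ x) (fderivWithin ℝ φ S x a) (fderivWithin ℝ φ S x b)) (u a b : E3) :
    fderivWithin ℝ G' S z u a b =
      fderivWithin ℝ G S (φ z) (fderivWithin ℝ φ S z u) (fderivWithin ℝ φ S z a)
        (fderivWithin ℝ φ S z b)
      + G (φ z) (fderivWithin ℝ (fderivWithin ℝ φ S) S z u a) (fderivWithin ℝ φ S z b)
      + G (φ z) (fderivWithin ℝ φ S z a) (fderivWithin ℝ (fderivWithin ℝ φ S) S z u b) := by
  have hd (a : E3) := hΦ.hasFDerivWithinAt.clm_apply (hasFDerivWithinAt_const a z S)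
  obtain ⟨L, h, h'⟩ := hasFDerivWithinAt_bil_apply
    (hG.hasFDerivWithinAt.comp z hφ.hasFDerivWithinAt hmaps) (hd a) (hd b)
  have h2 : HasFDerivWithinAt (fun x => G' x a b) L S z :=
    h.congr_of_eventuallyEq (hpull.mono fun x hx => by simp [hx])
      (by simp [hpull.self_of_nhdsWithin hz])
  rw [fderivWithin_bil_eval hS hz hG' h2, h']
  simp

/-- The chain rule applied twice: the ten terms record how the two differentiations fall on `G ∘ φ`
and on the two factors `dφ`. The derivatives enter as variables with equations so that a caller can
abstract them. -/
lemma hessMetric_pullback {S : Set E3} (hS : UniqueDiffOn ℝ S)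
    {G G' : E3 → Bil} {φ : E3 → E3} {y : E3} (hy : y ∈ S) (hmaps : MapsTo φ S S)
    (hφ : ContDiffWithinAt ℝ ∞ φ S y)
    (hG : ContDiffWithinAt ℝ ∞ G S (φ y)) (hG' : ContDiffWithinAt ℝ ∞ G' S y)
    (hpull : ∀ᶠ x in 𝓝[S] y, ∀ a b,
      G' x a b = G (φ x) (fderivWithin ℝ φ S x a) (fderivWithin ℝ φ S x b)) (u v a b : E3)
    {P : E3 →L[ℝ] E3} (hP : P = fderivWithin ℝ φ S y)
    {Q : E3 →L[ℝ] E3 →L[ℝ] E3} (hQ : Q = fderivWithin ℝ (fderivWithin ℝ φ S) S y)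
    {R : E3 →L[ℝ] E3 →L[ℝ] E3 →L[ℝ] E3}
    (hR : R = fderivWithin ℝ (fderivWithin ℝ (fderivWithin ℝ φ S) S) S y)
    {D : E3 →L[ℝ] Bil} (hD : D = fderivWithin ℝ G S (φ y))
    {g : Bil} (hg : g = G (φ y)) :
    hessMetric S G' y u v a b =
      hessMetric S G (φ y) (P u) (P v) (P a) (P b)
      + D (Q u v) (P a) (P b) + D (P v) (Q u a) (P b) + D (P v) (P a) (Q u b)
      + D (P u) (Q v a) (P b) + g (R u v a) (P b) + g (Q v a) (Q u b)
      + D (P u) (P a) (Q v b) + g (Q u a) (Q v b) + g (P a) (R u v b) := by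
  have hΦ := smooth_fderivWithin hS hy hφ
  have hΦ₂ := smooth_fderivWithin hS hy hΦ
  have hDG := smooth_fderivWithin hS (hmaps hy) hG
  have hDG' := smooth_fderivWithin hS hy hG'
  have hcont : Tendsto φ (𝓝[S] y) (𝓝[S] (φ y)) :=
    hφ.continuousWithinAt.tendsto_nhdsWithin hmaps
  have key : ∀ᶠ z in 𝓝[S] y, fderivWithin ℝ G' S z v a b =
      fderivWithin ℝ G S (φ z) (fderivWithin ℝ φ S z v) (fderivWithin ℝ φ S z a)
        (fderivWithin ℝ φ S z b)
      + G (φ z) (fderivWithin ℝ (fderivWithin ℝ φ S) S z v a) (fderivWithin ℝ φ S z b)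
      + G (φ z) (fderivWithin ℝ φ S z a) (fderivWithin ℝ (fderivWithin ℝ φ S) S z v b) := by
    filter_upwards [eventually_smooth hy hφ, eventually_smooth hy hΦ, eventually_smooth hy hG',
      hcont.eventually (eventually_smooth (hmaps hy) hG), self_mem_nhdsWithin,
      eventually_eventually_nhdsWithin.2 hpull]
      with z h1 h2 h3 h4 h5 h6
    exact fderivWithin_pullback hS h5 hmaps (h1.differentiableWithinAt (by simp))
      (h2.differentiableWithinAt (by simp)) (h4.differentiableWithinAt (by simp))
      (h3.differentiableWithinAt (by simp)) h6 v a b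
  have dφ := (hφ.differentiableWithinAt (by simp)).hasFDerivWithinAt
  have dΦ := (hΦ.differentiableWithinAt (by simp)).hasFDerivWithinAt
  have dΦ₂ := (hΦ₂.differentiableWithinAt (by simp)).hasFDerivWithinAt
  have dG := ((hG.differentiableWithinAt (by simp)).hasFDerivWithinAt.comp y dφ hmaps)
  have dDG := ((hDG.differentiableWithinAt (by simp)).hasFDerivWithinAt.comp y dφ hmaps)
  have e1 (a : E3) := dΦ.clm_apply (hasFDerivWithinAt_const a y S)
  have e2 (v a : E3) := (dΦ₂.clm_apply (hasFDerivWithinAt_const v y S)).clm_apply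
    (hasFDerivWithinAt_const a y S)
  obtain ⟨L1, l1, l1'⟩ := hasFDerivWithinAt_tri_apply dDG (e1 v) (e1 a) (e1 b)
  obtain ⟨L2, l2, l2'⟩ := hasFDerivWithinAt_bil_apply dG (e2 v a) (e1 b)
  obtain ⟨L3, l3, l3'⟩ := hasFDerivWithinAt_bil_apply dG (e1 a) (e2 v b)
  have hL := ((l1.add l2).add l3).congr_of_eventuallyEq
    (f₁ := fun z => fderivWithin ℝ G' S z v a b)
    (key.mono fun x hx => by simp [hx]) (by simp [key.self_of_nhdsWithin hy])
  rw [hessMetric_eval hS hy (hDG'.differentiableWithinAt (by simp)) hL u]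
  subst hP hQ hR hD hg
  simp only [add_apply, l1', l2', l3', hessMetric]
  simp
  ring

/-! ### Christoffel symbols and the index symmetries of the curvature expression. -/

lemma eq_sum_stdVec (w : E3) : w = ∑ i, w i • stdVec i := by
  ext j
  simp [stdVec, Finset.sum_apply, Pi.single_apply]

lemma gram_mulVec (G : E3 → Bil) (y : E3) (x : Fin 3 → ℝ) (i : Fin 3) :
    (gram G y).mulVec x i = G y (stdVec i) (WithLp.toLp 2 x) := by
  conv_rhs => rw [eq_sum_stdVec (WithLp.toLp 2 x)]
  simp [Matrix.mulVec, dotProduct, gram, mul_comm]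

/-- A kernel vector of the Gram matrix would be a nonzero vector of zero length. -/
lemma isUnit_det_gram {G : E3 → Bil} {y : E3} (hpos : ∀ u, u ≠ 0 → 0 < G y u u) :
    IsUnit (gram G y).det := by
  rw [isUnit_iff_ne_zero]
  intro h
  obtain ⟨x, hx, hx'⟩ := Matrix.exists_mulVec_eq_zero_iff.2 h
  have h1 : G y (WithLp.toLp 2 x) (WithLp.toLp 2 x) = 0 := by
    nth_rewrite 1 [eq_sum_stdVec (WithLp.toLp 2 x)]
    have : ∀ i, G y (stdVec i) (WithLp.toLp 2 x) = 0 := fun i => by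
      rw [← gram_mulVec, hx']; rfl
    simp [this]
  have h2 : (WithLp.toLp 2 x : E3) ≠ 0 := by
    intro h
    apply hx
    simpa using h
  exact (hpos _ h2).ne' h1

lemma christoffelFirst_linear_right (S : Set E3) (G : E3 → Bil) (y u v : E3) :
    ∃ L : E3 →L[ℝ] ℝ, ∀ w, L w = christoffelFirst S G y u v w := by
  refine ⟨(1 / 2 : ℝ) • (fderivWithin ℝ G S y u v + fderivWithin ℝ G S y v u
    - (((fderivWithin ℝ G S y).flip u).flip v)), fun w => ?_⟩
  simp [christoffelFirst]

/-- Lowering the index undoes the inverse Gram matrix. Computations with `christoffel` can thus be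
replaced by pairings, with no matrix inverse. -/
lemma metric_christoffel {S : Set E3} {G : E3 → Bil} {y : E3}
    (hpos : ∀ u, u ≠ 0 → 0 < G y u u) (hsymm : ∀ u w, G y u w = G y w u) (u v w : E3) :
    G y (christoffel S G y u v) w = christoffelFirst S G y u v w := by
  obtain ⟨L, hL⟩ := christoffelFirst_linear_right S G y u v
  have key (i : Fin 3) : G y (stdVec i) (christoffel S G y u v) = L (stdVec i) := by
    have : christoffel S G y u v =
        WithLp.toLp 2 ((gram G y)⁻¹.mulVec fun l => L (stdVec l)) := by
      ext k
      simp [christoffel, Matrix.mulVec, dotProduct, hL]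
    rw [this, ← gram_mulVec, Matrix.mulVec_mulVec,
      Matrix.mul_nonsing_inv _ (isUnit_det_gram hpos), Matrix.one_mulVec]
  rw [← hL, hsymm, eq_sum_stdVec w]
  simp [key]

lemma fderivWithin_metric_symm {S : Set E3} (hS : UniqueDiffOn ℝ S) {z : E3} (hz : z ∈ S)
    {G : E3 → Bil} (hG : DifferentiableWithinAt ℝ G S z)
    (hsymm : ∀ᶠ x in 𝓝[S] z, ∀ u w, G x u w = G x w u) (u a b : E3) :
    fderivWithin ℝ G S z u a b = fderivWithin ℝ G S z u b a := by
  obtain ⟨L, h, h'⟩ := hasFDerivWithinAt_bil_apply hG.hasFDerivWithinAt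
    (hasFDerivWithinAt_const b z S) (hasFDerivWithinAt_const a z S)
  have h2 : HasFDerivWithinAt (fun x => G x a b) L S z :=
    h.congr_of_eventuallyEq (hsymm.mono fun x hx => hx _ _) (hsymm.self_of_nhdsWithin hz _ _)
  rw [fderivWithin_bil_eval hS hz hG h2, h']
  simp

lemma hessMetric_symm_right {S : Set E3} (hS : UniqueDiffOn ℝ S) {y : E3} (hy : y ∈ S)
    {G : E3 → Bil} (hG : ContDiffWithinAt ℝ ∞ G S y)
    (hsymm : ∀ᶠ x in 𝓝[S] y, ∀ u w, G x u w = G x w u) (u v a b : E3) :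
    hessMetric S G y u v a b = hessMetric S G y u v b a := by
  have hDG := (smooth_fderivWithin hS hy hG).differentiableWithinAt (by simp)
  obtain ⟨L, h, h'⟩ := hasFDerivWithinAt_tri_apply hDG.hasFDerivWithinAt
    (hasFDerivWithinAt_const v y S)
    (hasFDerivWithinAt_const b y S) (hasFDerivWithinAt_const a y S)
  have key : ∀ᶠ x in 𝓝[S] y, fderivWithin ℝ G S x v a b = fderivWithin ℝ G S x v b a := by
    filter_upwards [eventually_smooth hy hG, self_mem_nhdsWithin,
      eventually_eventually_nhdsWithin.2 hsymm] with x h1 h2 h3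
    exact fderivWithin_metric_symm hS h2 (h1.differentiableWithinAt (by simp)) h3 v a b
  have h2 : HasFDerivWithinAt (fun x => fderivWithin ℝ G S x v a b) L S y :=
    h.congr_of_eventuallyEq key (key.self_of_nhdsWithin hy)
  rw [hessMetric_eval hS hy hDG h2, h']
  simp [hessMetric]

/-- At a boundary point of `S` the symmetry is inherited from interior points by continuity, whence
the closure hypothesis. -/
lemma fderivWithin_fderivWithin_symm {F : Type*} [NormedAddCommGroup F] [NormedSpace ℝ F]
    {S : Set E3} (hS : UniqueDiffOn ℝ S) {y : E3} (hy : y ∈ S)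
    (hyc : y ∈ closure (interior S)) {f : E3 → F} (hf : ContDiffWithinAt ℝ 3 f S y) (u v : E3) :
    fderivWithin ℝ (fderivWithin ℝ f S) S y u v = fderivWithin ℝ (fderivWithin ℝ f S) S y v u :=
  (hf.isSymmSndFDerivWithinAt (by simp; norm_num) hS hyc hy).eq u v

lemma hessMetric_symm_left {S : Set E3} (hS : UniqueDiffOn ℝ S) {y : E3} (hy : y ∈ S)
    (hyc : y ∈ closure (interior S)) {G : E3 → Bil} (hG : ContDiffWithinAt ℝ ∞ G S y)
    (u v a b : E3) : hessMetric S G y u v a b = hessMetric S G y v u a b := by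
  rw [hessMetric, hessMetric,
    fderivWithin_fderivWithin_symm hS hy hyc (hG.of_le ENat.LEInfty.out)]

lemma christoffelFirst_symm {S : Set E3} (hS : UniqueDiffOn ℝ S) {y : E3} (hy : y ∈ S)
    {G : E3 → Bil} (hG : DifferentiableWithinAt ℝ G S y)
    (hsymm : ∀ᶠ x in 𝓝[S] y, ∀ u w, G x u w = G x w u) (u v w : E3) :
    christoffelFirst S G y u v w = christoffelFirst S G y v u w := by
  rw [christoffelFirst, christoffelFirst, fderivWithin_metric_symm hS hy hG hsymm w u v]
  ring

lemma christoffel_symm {S : Set E3} (hS : UniqueDiffOn ℝ S) {y : E3} (hy : y ∈ S)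
    {G : E3 → Bil} (hG : DifferentiableWithinAt ℝ G S y)
    (hsymm : ∀ᶠ x in 𝓝[S] y, ∀ u w, G x u w = G x w u) (u v : E3) :
    christoffel S G y u v = christoffel S G y v u := by
  simp only [christoffel, christoffelFirst_symm hS hy hG hsymm u v]

/-- The pair symmetry of the curvature expression in its directional form. -/
lemma riemann_directional_symm {S : Set E3} (hS : UniqueDiffOn ℝ S) {y : E3} (hy : y ∈ S)
    (hyc : y ∈ closure (interior S)) {G : E3 → Bil} (hG : ContDiffWithinAt ℝ ∞ G S y)
    (hsymm : ∀ᶠ x in 𝓝[S] y, ∀ u w, G x u w = G x w u) (a b v : E3) :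
    riemann S G y a v b v = riemann S G y b v a v := by
  have hd := hG.differentiableWithinAt (by simp : (∞ : WithTop ℕ∞) ≠ 0)
  have h1 := hessMetric_symm_left hS hy hyc hG v b a v
  have h2 := hessMetric_symm_left hS hy hyc hG a v v b
  have h3 := hessMetric_symm_right hS hy hG hsymm b v a v
  have h4 := hessMetric_symm_right hS hy hG hsymm v a v b
  have h5 := hessMetric_symm_right hS hy hG hsymm v v a b
  have h6 := hessMetric_symm_left hS hy hyc hG a b v v
  have h7 := hsymm.self_of_nhdsWithin hy (christoffel S G y v b) (christoffel S G y a v)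
  rw [riemann, riemann, christoffel_symm hS hy hd hsymm a b, christoffel_symm hS hy hd hsymm b v,
    christoffel_symm hS hy hd hsymm v a]
  linear_combination (1 / 2 : ℝ) * (h1 + h2 + h3 + h4 - h5 - h6) + h7

lemma riemann_self_left (S : Set E3) (G : E3 → Bil) (y a c d : E3)
    (hsymm : ∀ u w, G y u w = G y w u) :
    riemann S G y a a c d = 0 := by
  rw [riemann, hsymm (christoffel S G y a d)]
  ring

-- The Christoffel symbols transform with the inhomogeneous term `Q = D²φ`. In the alternating sum
-- of Hessians the third derivatives of `φ` cancel by total symmetry, and the terms containing `Q`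
-- cancel against those produced by the quadratic Christoffel part.
set_option maxHeartbeats 1000000 in
theorem riemann_pullback {S : Set E3} (hS : UniqueDiffOn ℝ S)
    {G G' : E3 → Bil} {φ : E3 → E3} {y : E3} (hy : y ∈ S) (hSc : S ⊆ closure (interior S))
    (hmaps : MapsTo φ S S) (hφ : ContDiffWithinAt ℝ ∞ φ S y)
    (hG : ContDiffWithinAt ℝ ∞ G S (φ y)) (hG' : ContDiffWithinAt ℝ ∞ G' S y)
    (hpull : ∀ᶠ x in 𝓝[S] y, ∀ a b,
      G' x a b = G (φ x) (fderivWithin ℝ φ S x a) (fderivWithin ℝ φ S x b))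
    (hsymm : ∀ᶠ x in 𝓝[S] (φ y), ∀ u w, G x u w = G x w u)
    (hpos : ∀ u, u ≠ 0 → 0 < G (φ y) u u)
    (hinv : Function.Bijective (fderivWithin ℝ φ S y)) (a b c d : E3) :
    riemann S G' y a b c d = riemann S G (φ y) (fderivWithin ℝ φ S y a) (fderivWithin ℝ φ S y b)
      (fderivWithin ℝ φ S y c) (fderivWithin ℝ φ S y d) := by
  have hΦ := smooth_fderivWithin hS hy hφ
  have hdG := hG.differentiableWithinAt (by simp : (∞ : WithTop ℕ∞) ≠ 0)
  have hsy := hsymm.self_of_nhdsWithin (hmaps hy)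
  have hH := @hessMetric_pullback S hS G G' φ y hy hmaps hφ hG hG' hpull
  have hD' := @fderivWithin_pullback S hS G G' φ y hy hmaps
    (hφ.differentiableWithinAt (by simp)) (hΦ.differentiableWithinAt (by simp)) hdG
    (hG'.differentiableWithinAt (by simp)) hpull
  have hQs := fderivWithin_fderivWithin_symm hS hy (hSc hy)
    (hφ.of_le ENat.LEInfty.out)
  have hRs1 := fderivWithin_fderivWithin_symm hS hy (hSc hy)
    (hΦ.of_le ENat.LEInfty.out)
  -- Symmetry in the last two slots comes from differentiating the symmetry of the second
  -- derivative, which holds at all nearby points of `S`.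
  have hRs2 : ∀ u v w, fderivWithin ℝ (fderivWithin ℝ (fderivWithin ℝ φ S) S) S y u v w =
      fderivWithin ℝ (fderivWithin ℝ (fderivWithin ℝ φ S) S) S y u w v := by
    intro u v w
    have hΦ₂ := (smooth_fderivWithin hS hy hΦ).differentiableWithinAt
      (by simp : (∞ : WithTop ℕ∞) ≠ 0) |>.hasFDerivWithinAt
    have key : ∀ᶠ z in 𝓝[S] y, fderivWithin ℝ (fderivWithin ℝ φ S) S z v w =
        fderivWithin ℝ (fderivWithin ℝ φ S) S z w v := by
      filter_upwards [eventually_smooth hy hφ, self_mem_nhdsWithin] with z h1 h2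
      exact fderivWithin_fderivWithin_symm hS h2 (hSc h2) h1 v w
    have e (v w : E3) := (hΦ₂.clm_apply (hasFDerivWithinAt_const v y S)).clm_apply
      (hasFDerivWithinAt_const w y S)
    have := (hS y hy).eq (e v w) ((e w v).congr_of_eventuallyEq key (key.self_of_nhdsWithin hy))
    simpa using congrArg (fun L => L u) this
  have hDs := fderivWithin_metric_symm hS (hmaps hy) hdG hsymm
  have hGinv : ∀ u w, G' y u w = G (φ y) (fderivWithin ℝ φ S y u) (fderivWithin ℝ φ S y w) :=
    hpull.self_of_nhdsWithin hy
  have hsy' : ∀ u w, G' y u w = G' y w u := fun u w => by rw [hGinv, hGinv, hsy]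
  have hpos' : ∀ u, u ≠ 0 → 0 < G' y u u := fun u hu => by
    rw [hGinv]
    refine hpos _ fun h => hu (hinv.1 (by rw [h, map_zero]))
  have hΓ' := @metric_christoffel S G' y hpos' hsy'
  have hΓ := @metric_christoffel S G (φ y) hpos hsy
  generalize hP : fderivWithin ℝ φ S y = P at *
  generalize hQ : fderivWithin ℝ (fderivWithin ℝ φ S) S y = Q at *
  generalize hR : fderivWithin ℝ (fderivWithin ℝ (fderivWithin ℝ φ S) S) S y = R at *
  generalize hD : fderivWithin ℝ G S (φ y) = D at *
  generalize hg : G (φ y) = g at *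
  have hΓP (u v : E3) : P (christoffel S G' y u v) = christoffel S G (φ y) (P u) (P v) + Q u v := by
    rw [← sub_eq_zero]
    by_contra hne
    refine (hpos _ hne).ne' ?_
    -- Surjectivity of `P` writes the defect as `P w`; its pairing with itself then reduces to
    -- Christoffel symbols of the first kind and vanishes, against positivity.
    obtain ⟨w, hw⟩ := hinv.2 (P (christoffel S G' y u v) -
      (christoffel S G (φ y) (P u) (P v) + Q u v))
    rw [← hw]
    nth_rewrite 1 [hw]
    rw [map_sub, map_add, sub_apply, add_apply, ← hGinv, hΓ', hΓ, christoffelFirst,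
      christoffelFirst, hD', hD', hD', hD, hQs v u, hQs w u, hQs w v]
    linear_combination (1 / 2 : ℝ) * hsy (P v) (Q u w)
  have hΓ2 (u v w : E3) : g (christoffel S G (φ y) (P u) (P v)) w =
      1 / 2 * (D (P u) (P v) w + D (P v) (P u) w - D w (P u) (P v)) := by
    rw [hΓ, christoffelFirst, hD]
  have hΓ3 (u v w : E3) : g w (christoffel S G (φ y) (P u) (P v)) =
      1 / 2 * (D (P u) (P v) w + D (P v) (P u) w - D w (P u) (P v)) := by
    rw [hsy, hΓ2]
  have hGG (x u v w : E3) : G' y (christoffel S G' y x u) (christoffel S G' y v w) =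
      g (christoffel S G (φ y) (P x) (P u)) (christoffel S G (φ y) (P v) (P w))
      + 1 / 2 * (D (P x) (P u) (Q v w) + D (P u) (P x) (Q v w) - D (Q v w) (P x) (P u))
      + 1 / 2 * (D (P v) (P w) (Q x u) + D (P w) (P v) (Q x u) - D (Q x u) (P v) (P w))
      + g (Q x u) (Q v w) := by
    rw [hGinv, hΓP, hΓP, map_add, map_add, add_apply, add_apply, hΓ3 _ _ (Q x u), hΓ2 _ _ (Q v w)]
    ring
  have hH' (u v a b : E3) := hH u v a b rfl rfl rfl rfl rfl
  rw [riemann, riemann, hGG, hGG, hH', hH', hH', hH', hg]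
  simp only [hsy, hDs, hQs, hRs1, hRs2]
  ring

/-! ### The metric and the curvature in different charts -/

section Charts

variable {M : Type*} [TopologicalSpace M] [ChartedSpace (EuclideanHalfSpace 3) M]
  [IsManifold (𝓡∂ 3) ∞ M]

/-- The vector field with constant components `u` in the chart around `x`. -/
def coordField (x : M) (u : E3) (q : M) : TangentSpace (𝓡∂ 3) q :=
  tangentCoordChange (𝓡∂ 3) x q q u

/-- In the trivialization at `x` this section is the constant `u`. -/
lemma contMDiffAt_coordField (x : M) {p : M} (hp : p ∈ (extChartAt (𝓡∂ 3) x).source) (u : E3) :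
    ContMDiffAt (𝓡∂ 3) ((𝓡∂ 3).prod 𝓘(ℝ, E3)) ∞
      (fun q : M => Bundle.TotalSpace.mk' E3 (E := fun q : M => TangentSpace (𝓡∂ 3) q) q
        (coordField x u q)) p := by
  have hp' : p ∈ (trivializationAt E3 (TangentSpace (𝓡∂ 3)) x).baseSet := by
    simpa using hp
  rw [(trivializationAt E3 (TangentSpace (𝓡∂ 3)) x).contMDiffAt_section_iff hp']
  refine (contMDiffAt_const (c := u)).congr_of_eventuallyEq ?_
  filter_upwards [(isOpen_extChartAt_source (I := 𝓡∂ 3) x).mem_nhds hp] with q hq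
  change tangentCoordChange (𝓡∂ 3) q x q (tangentCoordChange (𝓡∂ 3) x q q u) = u
  rw [tangentCoordChange_comp ⟨⟨hq, mem_extChartAt_source q⟩, hq⟩, tangentCoordChange_self hq]

/-- Each coefficient is the smooth bundle metric evaluated on two smooth coordinate fields. -/
lemma contDiffWithinAt_metricInChart (g : Metric M) (x : M) {y : E3}
    (hy : y ∈ (extChartAt (𝓡∂ 3) x).target) :
    ContDiffWithinAt ℝ ∞ (metricInChart g x) (range (𝓡∂ 3)) y := by
  suffices h : ContDiffOn ℝ ∞ (metricInChart g x) (extChartAt (𝓡∂ 3) x).target from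
    (h y hy).mono_of_mem_nhdsWithin (extChartAt_target_mem_nhdsWithin_of_mem hy)
  refine contDiffOn_clm_apply.2 fun u => contDiffOn_clm_apply.2 fun w => fun y hy => ?_
  rw [← contMDiffWithinAt_iff_contDiffWithinAt]
  have hb := contMDiffWithinAt_extChartAt_symm_target (n := ∞) x hy
  have hp := (extChartAt (𝓡∂ 3) x).map_target hy
  have : ContMDiffWithinAt 𝓘(ℝ, E3) ((𝓡∂ 3).prod 𝓘(ℝ)) ∞
      (fun y => Bundle.TotalSpace.mk' ℝ (E := Bundle.Trivial M ℝ) ((extChartAt (𝓡∂ 3) x).symm y)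
        (metricInChart g x y u w)) (extChartAt (𝓡∂ 3) x).target y := by
    refine ContMDiffWithinAt.clm_bundle_apply₂ (F₁ := E3) (F₂ := E3)
      (E₁ := fun p : M => TangentSpace (𝓡∂ 3) p) (E₂ := fun p : M => TangentSpace (𝓡∂ 3) p)
      (E₃ := Bundle.Trivial M ℝ) (b := (extChartAt (𝓡∂ 3) x).symm)
      (ψ := fun y => g.inner ((extChartAt (𝓡∂ 3) x).symm y))
      (v := fun y => coordField x u ((extChartAt (𝓡∂ 3) x).symm y))
      (w := fun y => coordField x w ((extChartAt (𝓡∂ 3) x).symm y)) ?_ ?_ ?_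
    · exact ContMDiffAt.comp_contMDiffWithinAt y g.contMDiff.contMDiffAt hb
    · exact ContMDiffAt.comp_contMDiffWithinAt y (contMDiffAt_coordField x hp u) hb
    · exact ContMDiffAt.comp_contMDiffWithinAt y (contMDiffAt_coordField x hp w) hb
  rw [Bundle.contMDiffWithinAt_totalSpace] at this
  exact this.2

lemma metricInChart_symm (g : Metric M) (x : M) (y u w : E3) :
    metricInChart g x y u w = metricInChart g x y w u :=
  g.symm _ _ _

lemma bijective_tangentCoordChange (x x' : M) {p : M} (hp : p ∈ (extChartAt (𝓡∂ 3) x).source)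
    (hp' : p ∈ (extChartAt (𝓡∂ 3) x').source) :
    Function.Bijective (tangentCoordChange (𝓡∂ 3) x x' p) := by
  refine Function.bijective_iff_has_inverse.2 ⟨tangentCoordChange (𝓡∂ 3) x' x p, fun u => ?_,
    fun u => ?_⟩
  · rw [tangentCoordChange_comp ⟨⟨hp, hp'⟩, hp⟩, tangentCoordChange_self hp]
  · rw [tangentCoordChange_comp ⟨⟨hp', hp⟩, hp'⟩, tangentCoordChange_self hp']

lemma metricInChart_pos (g : Metric M) (x : M) {y : E3}
    (hy : y ∈ (extChartAt (𝓡∂ 3) x).target) {u : E3} (hu : u ≠ 0) :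
    0 < metricInChart g x y u u := by
  have hp := (extChartAt (𝓡∂ 3) x).map_target hy
  refine g.pos _ _ fun h => hu ?_
  refine (bijective_tangentCoordChange x _ hp (mem_extChartAt_source _)).1 (h.trans ?_)
  exact (map_zero _).symm

/-- The curvature expressions in two charts agree. -/
theorem riemann_chart_change (g : Metric M) (x x' : M) {p : M}
    (hp : p ∈ (extChartAt (𝓡∂ 3) x).source) (hp' : p ∈ (extChartAt (𝓡∂ 3) x').source)
    (a b c d : E3) :
    riemann (range (𝓡∂ 3)) (metricInChart g x') (extChartAt (𝓡∂ 3) x' p) a b c d =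
      riemann (range (𝓡∂ 3)) (metricInChart g x) (extChartAt (𝓡∂ 3) x p)
        (tangentCoordChange (𝓡∂ 3) x' x p a) (tangentCoordChange (𝓡∂ 3) x' x p b)
        (tangentCoordChange (𝓡∂ 3) x' x p c) (tangentCoordChange (𝓡∂ 3) x' x p d) := by
  set φ : E3 → E3 := extChartAt (𝓡∂ 3) x ∘ (extChartAt (𝓡∂ 3) x').symm with hφdef
  have hφp : φ (extChartAt (𝓡∂ 3) x' p) = extChartAt (𝓡∂ 3) x p := by
    simp only [hφdef, Function.comp, (extChartAt (𝓡∂ 3) x').left_inv hp']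
  have hy := (extChartAt (𝓡∂ 3) x').map_source hp'
  have hyr := extChartAt_target_subset_range (I := 𝓡∂ 3) x' hy
  have hφ : ContDiffWithinAt ℝ ∞ φ (range (𝓡∂ 3)) (extChartAt (𝓡∂ 3) x' p) := by
    refine contDiffWithinAt_ext_coord_change x x' ?_
    rw [PartialEquiv.trans_source'', PartialEquiv.symm_symm, PartialEquiv.symm_target]
    exact mem_image_of_mem _ ⟨hp', hp⟩
  have hpull : ∀ᶠ z in 𝓝[range (𝓡∂ 3)] (extChartAt (𝓡∂ 3) x' p), ∀ a b,
      metricInChart g x' z a b = metricInChart g x (φ z) (fderivWithin ℝ φ (range (𝓡∂ 3)) z a)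
        (fderivWithin ℝ φ (range (𝓡∂ 3)) z b) := by
    have h1 := extChartAt_target_mem_nhdsWithin_of_mem (I := 𝓡∂ 3) hy
    have h2 : ∀ᶠ z in 𝓝[range (𝓡∂ 3)] (extChartAt (𝓡∂ 3) x' p),
        (extChartAt (𝓡∂ 3) x').symm z ∈ (extChartAt (𝓡∂ 3) x).source := by
      have hc := (continuousAt_extChartAt_symm' (I := 𝓡∂ 3) hp').continuousWithinAt
        (s := range (𝓡∂ 3))
      refine hc.tendsto.eventually ?_
      rw [(extChartAt (𝓡∂ 3) x').left_inv hp']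
      exact (isOpen_extChartAt_source (I := 𝓡∂ 3) x).mem_nhds hp
    filter_upwards [h1, h2] with z hz hz2 u w
    have hq := (extChartAt (𝓡∂ 3) x').map_target hz
    set q : M := (extChartAt (𝓡∂ 3) x').symm z with hqdef
    have hzq : z = extChartAt (𝓡∂ 3) x' q := ((extChartAt (𝓡∂ 3) x').right_inv hz).symm
    have hφz : φ z = extChartAt (𝓡∂ 3) x q := rfl
    -- `tangentCoordChange` is by definition the derivative of the transition map within the range
    -- of the model.
    have hd : fderivWithin ℝ φ (range (𝓡∂ 3)) z = tangentCoordChange (𝓡∂ 3) x' x q := by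
      rw [hzq]; rfl
    have hinv : (extChartAt (𝓡∂ 3) x).symm (extChartAt (𝓡∂ 3) x q) = q :=
      (extChartAt (𝓡∂ 3) x).left_inv hz2
    rw [hd, hφz]
    have e1 : metricInChart g x' z u w = metricAt g q (tangentCoordChange (𝓡∂ 3) x' q q u)
      (tangentCoordChange (𝓡∂ 3) x' q q w) := rfl
    have e2 (u w : E3) : metricInChart g x (extChartAt (𝓡∂ 3) x q) u w =
        metricAt g q (tangentCoordChange (𝓡∂ 3) x q q u) (tangentCoordChange (𝓡∂ 3) x q q w) := by
      -- The point occurs in the type of the tangent space, so it is generalized and substituted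
      -- instead of rewritten.
      have : ∀ r : M, r = q → ((metricAt g r).bilinearComp (tangentCoordChange (𝓡∂ 3) x r r)
          (tangentCoordChange (𝓡∂ 3) x r r) : Bil) u w =
          metricAt g q (tangentCoordChange (𝓡∂ 3) x q q u)
            (tangentCoordChange (𝓡∂ 3) x q q w) := by
        rintro r rfl
        rfl
      exact this _ hinv
    rw [e1, e2, tangentCoordChange_comp ⟨⟨hq, hz2⟩, mem_extChartAt_source q⟩,
      tangentCoordChange_comp ⟨⟨hq, hz2⟩, mem_extChartAt_source q⟩]
  have hmaps : MapsTo φ (range (𝓡∂ 3)) (range (𝓡∂ 3)) := fun z _ =>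
    mem_range_self (f := (𝓡∂ 3)) (chartAt _ x ((extChartAt (𝓡∂ 3) x').symm z))
  have h := riemann_pullback (𝓡∂ 3).uniqueDiffOn hyr (𝓡∂ 3).range_subset_closure_interior hmaps hφ
    (by rw [hφp]; exact contDiffWithinAt_metricInChart g x ((extChartAt (𝓡∂ 3) x).map_source hp))
    (contDiffWithinAt_metricInChart g x' hy) hpull
    (Eventually.of_forall fun z => metricInChart_symm g x z)
    (by rw [hφp]; exact fun u => metricInChart_pos g x ((extChartAt (𝓡∂ 3) x).map_source hp))
    (bijective_tangentCoordChange x' x hp' hp) a b c d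
  rw [hφp] at h
  exact h

/-- Replaces the chart centred at the moving point `p` by a fixed chart around `x`. -/
lemma riemannAt_eq_chart (g : Metric M) (x : M) {p : M}
    (hp : p ∈ (extChartAt (𝓡∂ 3) x).source) (a b c d : TangentSpace (𝓡∂ 3) p) :
    riemannAt g p a b c d =
      riemann (range (𝓡∂ 3)) (metricInChart g x) (extChartAt (𝓡∂ 3) x p)
        (chartVec x p a) (chartVec x p b) (chartVec x p c) (chartVec x p d) :=
  riemann_chart_change g x p hp (mem_extChartAt_source p) a b c d

lemma riemannAt_directional_symm (g : Metric M) (p : M) (a b v : TangentSpace (𝓡∂ 3) p) :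
    riemannAt g p a v b v = riemannAt g p b v a v :=
  riemann_directional_symm (𝓡∂ 3).uniqueDiffOn (mem_range_self _)
    ((𝓡∂ 3).range_subset_closure_interior (mem_range_self _))
    (contDiffWithinAt_metricInChart g p (mem_extChartAt_target p))
    (Eventually.of_forall fun z => metricInChart_symm g p z) a b v

lemma riemannAt_self_left (g : Metric M) (p : M) (a c d : TangentSpace (𝓡∂ 3) p) :
    riemannAt g p a a c d = 0 :=
  riemann_self_left _ _ _ a c d fun u w => metricInChart_symm g p _ u w

end Charts

/-! ### Continuity of the curvature expression -/

section Continuity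

variable {X : Type*} [TopologicalSpace X] {s : Set X} {t₀ : X} {S : Set E3} {G : E3 → Bil}
  {y a b c d : X → E3}

lemma continuousWithinAt_christoffel
    (hG : ContinuousWithinAt (fun t => G (y t)) s t₀)
    (hDG : ContinuousWithinAt (fun t => fderivWithin ℝ G S (y t)) s t₀)
    (hpos : ∀ u, u ≠ 0 → 0 < G (y t₀) u u)
    (ha : ContinuousWithinAt a s t₀) (hb : ContinuousWithinAt b s t₀) :
    ContinuousWithinAt (fun t => christoffel S G (y t) (a t) (b t)) s t₀ := by
  have hgram : ContinuousWithinAt (fun t => gram G (y t)) s t₀ := by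
    refine continuousWithinAt_pi.2 fun i => continuousWithinAt_pi.2 fun j => ?_
    have h : ContinuousWithinAt (fun t => G (y t) (stdVec i)) s t₀ :=
      hG.clm_apply continuousWithinAt_const
    exact h.clm_apply continuousWithinAt_const
  have hinv : ContinuousWithinAt (fun t => (gram G (y t))⁻¹) s t₀ := by
    simp only [Matrix.inv_def, Ring.inverse_eq_inv']
    have hdet : ContinuousWithinAt (fun t => (gram G (y t)).det) s t₀ :=
      continuous_id.matrix_det.continuousAt.comp_continuousWithinAt hgram
    have hadj : ContinuousWithinAt (fun t => (gram G (y t)).adjugate) s t₀ :=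
      continuous_id.matrix_adjugate.continuousAt.comp_continuousWithinAt hgram
    exact (hdet.inv₀ (isUnit_det_gram hpos).ne_zero).smul hadj
  refine (PiLp.continuous_toLp 2 _).continuousAt.comp_continuousWithinAt
    (continuousWithinAt_pi.2 fun k => ?_)
  refine tendsto_finsetSum _ fun l _ => ContinuousWithinAt.mul ?_ ?_
  · exact continuousWithinAt_pi.1 (continuousWithinAt_pi.1 hinv k) l
  · simp only [christoffelFirst]
    refine continuousWithinAt_const.mul (ContinuousWithinAt.sub (ContinuousWithinAt.add ?_ ?_) ?_)
    · exact ((hDG.clm_apply ha).clm_apply hb).clm_apply continuousWithinAt_const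
    · exact ((hDG.clm_apply hb).clm_apply ha).clm_apply continuousWithinAt_const
    · exact ((hDG.clm_apply continuousWithinAt_const).clm_apply ha).clm_apply hb

lemma continuousWithinAt_riemann (hS : UniqueDiffOn ℝ S) (hyS : ∀ t, y t ∈ S)
    (hG : ContDiffWithinAt ℝ ∞ G S (y t₀)) (hpos : ∀ u, u ≠ 0 → 0 < G (y t₀) u u)
    (hy : ContinuousWithinAt y s t₀)
    (ha : ContinuousWithinAt a s t₀) (hb : ContinuousWithinAt b s t₀)
    (hc : ContinuousWithinAt c s t₀) (hd : ContinuousWithinAt d s t₀) :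
    ContinuousWithinAt (fun t => riemann S G (y t) (a t) (b t) (c t) (d t)) s t₀ := by
  have hDG := smooth_fderivWithin hS (hyS t₀) hG
  have hDDG := smooth_fderivWithin hS (hyS t₀) hDG
  have hm : MapsTo y s S := fun t _ => hyS t
  have cG := hG.continuousWithinAt.comp hy hm
  have cDG := hDG.continuousWithinAt.comp hy hm
  have cDDG := hDDG.continuousWithinAt.comp hy hm
  have hess {u v w z : X → E3} (hu : ContinuousWithinAt u s t₀) (hv : ContinuousWithinAt v s t₀)
      (hw : ContinuousWithinAt w s t₀) (hz : ContinuousWithinAt z s t₀) :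
      ContinuousWithinAt (fun t => hessMetric S G (y t) (u t) (v t) (w t) (z t)) s t₀ :=
    (((cDDG.clm_apply hu).clm_apply hv).clm_apply hw).clm_apply hz
  have chr {u v : X → E3} (hu : ContinuousWithinAt u s t₀) (hv : ContinuousWithinAt v s t₀) :
      ContinuousWithinAt (fun t => christoffel S G (y t) (u t) (v t)) s t₀ :=
    continuousWithinAt_christoffel cG cDG hpos hu hv
  simp only [riemann]
  refine ((continuousWithinAt_const.mul ?_).add ?_).sub ?_
  · exact (((hess hb hc ha hd).add (hess ha hd hb hc)).sub (hess hb hd ha hc)).sub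
      (hess ha hc hb hd)
  · exact (cG.clm_apply (chr hb hc)).clm_apply (chr ha hd)
  · exact (cG.clm_apply (chr hb hd)).clm_apply (chr ha hc)

end Continuity

/-! ### Linearity -/

lemma christoffel_sum_smul (S : Set E3) (G : E3 → Bil) (y u : E3) {ι : Type*} (I : Finset ι)
    (c : ι → ℝ) (w : ι → E3) :
    christoffel S G y u (∑ i ∈ I, c i • w i) = ∑ i ∈ I, c i • christoffel S G y u (w i) := by
  ext k
  simp only [christoffel, christoffelFirst, map_sum, map_smul, WithLp.ofLp_sum, WithLp.ofLp_smul,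
    Finset.sum_apply, Pi.smul_apply, FunLike.coe_sum, smul_apply, smul_eq_mul,
    Finset.mul_sum]
  rw [Finset.sum_comm]
  refine Finset.sum_congr rfl fun l _ => ?_
  simp only [← Finset.sum_add_distrib, ← Finset.sum_sub_distrib, Finset.mul_sum]
  exact Finset.sum_congr rfl fun i _ => by ring

lemma christoffel_add_left (S : Set E3) (G : E3 → Bil) (y u u' w : E3) :
    christoffel S G y (u + u') w = christoffel S G y u w + christoffel S G y u' w := by
  ext k
  simp only [christoffel, christoffelFirst, map_add, WithLp.ofLp_add, Pi.add_apply, add_apply,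
    ← Finset.sum_add_distrib]
  exact Finset.sum_congr rfl fun i _ => by ring

lemma christoffel_smul_left (S : Set E3) (G : E3 → Bil) (y u w : E3) (r : ℝ) :
    christoffel S G y (r • u) w = r • christoffel S G y u w := by
  ext k
  simp only [christoffel, christoffelFirst, map_smul, WithLp.ofLp_smul, Pi.smul_apply, smul_apply,
    smul_eq_mul, Finset.mul_sum]
  exact Finset.sum_congr rfl fun i _ => by ring

lemma riemann_linear_left (S : Set E3) (G : E3 → Bil) (y b c d : E3) :
    ∃ L : E3 →ₗ[ℝ] ℝ, ∀ a, L a = riemann S G y a b c d := by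
  refine ⟨⟨⟨fun a => riemann S G y a b c d, fun a a' => ?_⟩, fun r a => ?_⟩, fun a => rfl⟩
  · simp only [riemann, hessMetric, christoffel_add_left, map_add, add_apply]
    ring
  · simp only [riemann, hessMetric, christoffel_smul_left, map_smul, smul_apply, smul_eq_mul,
      RingHom.id_apply]
    ring

lemma riemann_sum_third (S : Set E3) (G : E3 → Bil) (y a b d : E3) {ι : Type*} (I : Finset ι)
    (c : ι → ℝ) (w : ι → E3) :
    riemann S G y a b (∑ i ∈ I, c i • w i) d = ∑ i ∈ I, c i * riemann S G y a b (w i) d := by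
  simp only [riemann, hessMetric, christoffel_sum_smul, map_sum, map_smul, smul_apply, smul_eq_mul,
    FunLike.coe_sum, Finset.sum_apply, Finset.mul_sum, ← Finset.sum_add_distrib,
    ← Finset.sum_sub_distrib]
  exact Finset.sum_congr rfl fun i _ => by ring

/-- Orthonormality forces independence, and three independent vectors span `ℝ³`. -/
lemma linearMap_eq_zero_of_orthonormal (B : Bil) {w : Fin 3 → E3}
    (hw : ∀ i j, B (w i) (w j) = if i = j then 1 else 0) (L : E3 →ₗ[ℝ] ℝ)
    (hL : ∀ i, L (w i) = 0) (u : E3) : L u = 0 := by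
  have hli : LinearIndependent ℝ w := by
    rw [Fintype.linearIndependent_iff]
    intro c hc i
    have := congrArg (fun x => B x (w i)) hc
    simpa [hw] using this
  have hspan := hli.span_eq_top_of_card_eq_finrank (by simp)
  have hu : u ∈ Submodule.span ℝ (range w) := by rw [hspan]; trivial
  have : Submodule.span ℝ (range w) ≤ LinearMap.ker L := by
    rw [Submodule.span_le]
    rintro _ ⟨i, rfl⟩
    exact hL i
  exact this hu

/-- The Jacobi equation has to be tested against every vector, not only normal ones. On the frame it
is the matrix equation; along `V` both terms vanish, the curvature term by antisymmetry. -/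
lemma jacobi_identity_of_frame {S : Set E3} {G : E3 → Bil} {y : E3} {B : Bil} {E : Fin 2 → E3}
    {V : E3} (hE : ∀ a b, B (E a) (E b) = if a = b then 1 else 0) (hEV : ∀ a, B (E a) V = 0)
    (hVE : ∀ a, B V (E a) = 0) (hV : B V V = 1)
    (hself : ∀ u c d, riemann S G y u u c d = 0) (c : Fin 2 → ℝ) (u : E3) :
    B (∑ a, (-∑ b, riemann S G y (E a) V (E b) V * c b) • E a) u +
      riemann S G y u V (∑ a, c a • E a) V = 0 := by
  set Z := ∑ a, (-∑ b, riemann S G y (E a) V (E b) V * c b) • E a with hZ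
  obtain ⟨L, hL⟩ := riemann_linear_left S G y V (∑ a, c a • E a) V
  have hin (x : E3) : B Z x =
      ∑ a, (-∑ b, riemann S G y (E a) V (E b) V * c b) * B (E a) x := by
    simp [hZ]
  have hfr (a : Fin 2) : B Z (E a) + L (E a) = 0 := by
    rw [hL, riemann_sum_third, hin]
    simp only [hE, mul_ite, mul_one, mul_zero, Finset.sum_ite_eq', Finset.mem_univ, if_true]
    rw [neg_add_eq_zero]
    exact Finset.sum_congr rfl fun b _ => mul_comm _ _
  rw [← hL]
  refine linearMap_eq_zero_of_orthonormal B (w := ![E 0, E 1, V]) (fun i j => ?_)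
    ((B Z).toLinearMap + L) (fun i => ?_) u
  · fin_cases i <;> fin_cases j <;> simp [hE, hEV, hVE, hV]
  · fin_cases i
    · exact hfr 0
    · exact hfr 1
    · change B Z V + L V = 0
      rw [hL, hself, hin]
      simp [hEV]

lemma coeff_eq_zero_of_orthonormal {B : Bil} {E : Fin 2 → E3}
    (hE : ∀ a b, B (E a) (E b) = if a = b then 1 else 0) {c : Fin 2 → ℝ}
    (h : ∑ a, c a • E a = 0) (a : Fin 2) : c a = 0 := by
  have := congrArg (fun x => B x (E a)) h
  simpa only [map_sum, map_smul, FunLike.coe_sum, Finset.sum_apply, smul_apply, smul_eq_mul, hE,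
    mul_ite, mul_one, mul_zero, Finset.sum_ite_eq', Finset.mem_univ, if_true, map_zero,
    zero_apply] using this

/-! ### The curvature matrix and Jacobi fields along a geodesic -/

section Geodesic

variable {M : Type*} [TopologicalSpace M] [ChartedSpace (EuclideanHalfSpace 3) M]
  [IsManifold (𝓡∂ 3) ∞ M] {g : Metric M} {ℓ : ℝ} {γ : ℝ → M}
  {v : (t : ℝ) → TangentSpace (𝓡∂ 3) (γ t)} {e : Fin 2 → (t : ℝ) → TangentSpace (𝓡∂ 3) (γ t)}

lemma chartVec_self (p : M) (V : TangentSpace (𝓡∂ 3) p) : chartVec p p V = V :=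
  tangentCoordChange_self (mem_extChartAt_source p)

/-- Near `t₀` everything is read in the chart of `γ t₀`, where the components of `v` and `e` are
continuous, being differentiable at `t₀` by the covariant derivative conditions. -/
lemma continuousOn_curvMatrix (hγ : IsUnitSpeedGeodesic g ℓ γ v)
    (he : IsParallelNormalFrame g ℓ γ v e) (a b : Fin 2) :
    ContinuousOn (fun t => curvMatrix g γ v e t a b) (Icc 0 ℓ) := by
  intro t₀ ht₀
  have hc := (hγ.velocity t₀ ht₀).continuousWithinAt
  have hsrc : ∀ᶠ t in 𝓝[Icc 0 ℓ] t₀, γ t ∈ (extChartAt (𝓡∂ 3) (γ t₀)).source :=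
    hc.tendsto.eventually ((isOpen_extChartAt_source (I := 𝓡∂ 3) (γ t₀)).mem_nhds
      (mem_extChartAt_source (γ t₀)))
  have hyc : ContinuousWithinAt (fun t => extChartAt (𝓡∂ 3) (γ t₀) (γ t)) (Icc 0 ℓ) t₀ :=
    (continuousAt_extChartAt (I := 𝓡∂ 3) (γ t₀)).comp_continuousWithinAt hc
  have hea (a : Fin 2) := (he.parallel a t₀ ht₀).continuousWithinAt
  have hv := (hγ.geodesic t₀ ht₀).continuousWithinAt
  have key := continuousWithinAt_riemann (𝓡∂ 3).uniqueDiffOn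
    (fun t => mem_range_self (f := 𝓡∂ 3) (chartAt _ (γ t₀) (γ t)))
    (contDiffWithinAt_metricInChart g (γ t₀) (mem_extChartAt_target (γ t₀)))
    (fun u => metricInChart_pos g (γ t₀) (mem_extChartAt_target (γ t₀)))
    hyc (hea a) hv (hea b) hv
  refine key.congr_of_eventuallyEq ?_ ?_
  · filter_upwards [hsrc] with t ht
    exact riemannAt_eq_chart g (γ t₀) ht _ _ _ _
  · exact riemannAt_eq_chart g (γ t₀) (mem_extChartAt_source _) _ _ _ _

lemma curvMatrix_symm (t : ℝ) (a b : Fin 2) :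
    curvMatrix g γ v e t a b = curvMatrix g γ v e t b a :=
  riemannAt_directional_symm g (γ t) _ _ _

/-- The field with components `c` in the frame `e`. -/
def frameField (γ : ℝ → M) (e : Fin 2 → (t : ℝ) → TangentSpace (𝓡∂ 3) (γ t)) (c : Fin 2 → ℝ → ℝ)
    (t : ℝ) : TangentSpace (𝓡∂ 3) (γ t) :=
  ∑ a, c a t • e a t

lemma chartVec_sum_smul (x p : M) {ι : Type*} (I : Finset ι) (c : ι → ℝ)
    (V : ι → TangentSpace (𝓡∂ 3) p) :
    chartVec x p (∑ i ∈ I, c i • V i) = ∑ i ∈ I, c i • chartVec x p (V i) := by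
  have h (L : E3 →L[ℝ] E3) (V : ι → E3) : L (∑ i ∈ I, c i • V i) = ∑ i ∈ I, c i • L (V i) := by
    simp
  exact h _ V

lemma hasCovDeriv_frameField (he : ∀ a, HasCovDeriv g ℓ γ v (e a) (fun _ => 0))
    {c c' : Fin 2 → ℝ → ℝ}
    (hc : ∀ t ∈ Icc 0 ℓ, ∀ a, HasDerivWithinAt (c a) (c' a t) (Icc 0 ℓ) t) :
    HasCovDeriv g ℓ γ v (frameField γ e c) (frameField γ e c') := by
  intro t ht
  have h := HasDerivWithinAt.fun_sum (u := Finset.univ) fun a _ => (hc t ht a).smul (he a t ht)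
  have e1 : (fun s => chartVec (γ t) (γ s) (frameField γ e c s)) =
      fun s => ∑ a, (c a • fun s => chartVec (γ t) (γ s) (e a s)) s := by
    funext s
    exact chartVec_sum_smul _ _ _ _ _
  rw [e1]
  refine h.congr_deriv ?_
  have e2 : christoffelAt g (γ t) (v t) (frameField γ e c t) =
      ∑ a, c a t • christoffelAt g (γ t) (v t) (e a t) :=
    christoffel_sum_smul _ _ _ _ _ _ _
  rw [e2]
  simp only [chartVec_self]
  have e3 (c c' : Fin 2 → ℝ) (x w : Fin 2 → E3) :
      ∑ a, (c a • (0 - x a) + c' a • w a) = ∑ a, c' a • w a - ∑ a, c a • x a := by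
    simp only [← Finset.sum_sub_distrib]
    exact Finset.sum_congr rfl fun a _ => by module
  exact e3 (fun a => c a t) (fun a => c' a t) (fun a => christoffelAt g (γ t) (v t) (e a t))
    (fun a => e a t)

lemma isJacobiField_frameField (hγ : IsUnitSpeedGeodesic g ℓ γ v)
    (he : IsParallelNormalFrame g ℓ γ v e) {c c' : Fin 2 → ℝ → ℝ}
    (hc : ∀ t ∈ Icc 0 ℓ, ∀ a, HasDerivWithinAt (c a) (c' a t) (Icc 0 ℓ) t)
    (hc' : ∀ t ∈ Icc 0 ℓ, ∀ a, HasDerivWithinAt (c' a)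
      (-∑ b, curvMatrix g γ v e t a b * c b t) (Icc 0 ℓ) t) :
    IsJacobiField g ℓ γ v (frameField γ e c) := by
  refine ⟨frameField γ e c', frameField γ e fun a t => -∑ b, curvMatrix g γ v e t a b * c b t,
    hasCovDeriv_frameField he.parallel hc, hasCovDeriv_frameField he.parallel hc',
    fun t ht u => ?_⟩
  exact jacobi_identity_of_frame (B := metricAt g (γ t)) (he.orthonormal t ht) (he.normal t ht)
    (fun a => (g.symm _ _ _).trans (he.normal t ht a)) (hγ.unit_speed t ht)
    (fun u => riemannAt_self_left g (γ t) u) (fun a => c a t) u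

/-- Absence of conjugate points, in terms of solutions of the Jacobi equation in the frame. -/
lemma frame_solution_ne_zero (hγ : IsUnitSpeedGeodesic g ℓ γ v)
    (he : IsParallelNormalFrame g ℓ γ v e) {s t : ℝ} (hs : s ∈ Icc 0 ℓ)
    (hℓ : 0 < ℓ) (hconj : ¬ AreConjugate g ℓ γ v s t) {c c' : Fin 2 → ℝ → ℝ}
    (hc : ∀ t ∈ Icc 0 ℓ, ∀ a, HasDerivWithinAt (c a) (c' a t) (Icc 0 ℓ) t)
    (hc' : ∀ t ∈ Icc 0 ℓ, ∀ a, HasDerivWithinAt (c' a)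
      (-∑ b, curvMatrix g γ v e t a b * c b t) (Icc 0 ℓ) t)
    (hcs : ∀ a, c a s = 0) (hct : ∀ a, c a t = 0) (a : Fin 2) : c' a s = 0 := by
  have hvan {r : ℝ} (h : ∀ a, c a r = 0) : frameField γ e c r = 0 := by simp [frameField, h]
  have hall : ∀ r ∈ Icc 0 ℓ, frameField γ e c r = 0 := by
    intro r hr
    by_contra hne
    exact hconj ⟨_, isJacobiField_frameField hγ he hc hc', hvan hcs, hvan hct, r, hr, hne⟩
  have hzero : ∀ r ∈ Icc 0 ℓ, c a r = 0 := fun r hr =>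
    coeff_eq_zero_of_orthonormal (B := metricAt g (γ r)) (c := fun a => c a r)
      (he.orthonormal r hr) (hall r hr) a
  -- The coefficient vanishes on the whole interval, so its derivative within the interval at `s` is
  -- both `0` and `c' a s`.
  have h0 : HasDerivWithinAt (c a) 0 (Icc 0 ℓ) s :=
    (hasDerivWithinAt_const s (Icc 0 ℓ) (0 : ℝ)).congr hzero (hcs a)
  exact (uniqueDiffOn_Icc hℓ s hs).eq_deriv _ (hc s hs a) h0

end Geodesic

/-! ### Concentration of the weights -/

lemma ofReal_sub_I_ne_zero (s : ℝ) : (s : ℂ) - Complex.I ≠ 0 := by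
  intro h
  simpa using congrArg Complex.im h

lemma norm_ofReal_sub_I_sq (s : ℝ) : ‖(s : ℂ) - Complex.I‖ ^ 2 = 1 + s ^ 2 := by
  rw [Complex.sq_norm, Complex.normSq_apply]
  simp
  ring

lemma one_le_norm_ofReal_sub_I (s : ℝ) : 1 ≤ ‖(s : ℂ) - Complex.I‖ := by
  nlinarith [norm_ofReal_sub_I_sq s, norm_nonneg ((s : ℂ) - Complex.I), sq_nonneg s]

lemma norm_kernel_le (m : ℕ) (s : ℝ) :
    ‖(((1 + s ^ 2 : ℝ) : ℂ))⁻¹ * (((s : ℂ) - Complex.I) ^ m)⁻¹‖ ≤ (1 + s ^ 2)⁻¹ := by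
  have h : (0 : ℝ) < 1 + s ^ 2 := by positivity
  rw [norm_mul, norm_inv, norm_inv, norm_pow, Complex.norm_real, Real.norm_of_nonneg h.le]
  exact mul_le_of_le_one_right (by positivity)
    (inv_le_one_of_one_le₀ (one_le_pow₀ (one_le_norm_ofReal_sub_I s)))

lemma continuous_kernel (m : ℕ) :
    Continuous fun s : ℝ => (((1 + s ^ 2 : ℝ) : ℂ))⁻¹ * (((s : ℂ) - Complex.I) ^ m)⁻¹ := by
  refine Continuous.mul (Continuous.inv₀ (by fun_prop) fun s => ?_)
    (Continuous.inv₀ (by fun_prop) fun s => pow_ne_zero _ (ofReal_sub_I_ne_zero s))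
  have h : (0 : ℝ) < 1 + s ^ 2 := by positivity
  exact_mod_cast h.ne'

lemma integrable_kernel (m : ℕ) :
    Integrable fun s : ℝ => (((1 + s ^ 2 : ℝ) : ℂ))⁻¹ * (((s : ℂ) - Complex.I) ^ m)⁻¹ :=
  integrable_inv_one_add_sq.mono' (continuous_kernel m).aestronglyMeasurable
    (Eventually.of_forall (norm_kernel_le m))

lemma integrable_inv_pow (m : ℕ) :
    Integrable fun s : ℝ => (((s : ℂ) - Complex.I) ^ (m + 2))⁻¹ := by
  refine integrable_inv_one_add_sq.mono' (Continuous.aestronglyMeasurable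
    (Continuous.inv₀ (by fun_prop) fun s => pow_ne_zero _ (ofReal_sub_I_ne_zero s)))
    (Eventually.of_forall fun s => ?_)
  rw [norm_inv, norm_pow]
  refine inv_anti₀ (by positivity) ?_
  rw [← norm_ofReal_sub_I_sq]
  exact pow_le_pow_right₀ (one_le_norm_ofReal_sub_I s) (by omega)

lemma tendsto_inv_pow_zero (m : ℕ) {l : Filter ℝ} (hl : Tendsto (fun s : ℝ => |s|) l atTop) :
    Tendsto (fun s : ℝ => (((s : ℂ) - Complex.I) ^ (m + 1))⁻¹) l (𝓝 0) := by
  refine squeeze_zero_norm' ?_ hl.inv_tendsto_atTop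
  filter_upwards [hl.eventually_gt_atTop 0] with s hs
  rw [norm_inv, norm_pow]
  refine inv_anti₀ hs ?_
  have h1 : |s| ≤ ‖(s : ℂ) - Complex.I‖ := by
    simpa using Complex.abs_re_le_norm ((s : ℂ) - Complex.I)
  exact h1.trans (le_self_pow₀ (one_le_norm_ofReal_sub_I s) (by omega))

/-- The integrand has the primitive `-(m+1)⁻¹ (s - i)^{-(m+1)}`, which vanishes at both infinities.
-/
lemma integral_inv_pow (m : ℕ) : ∫ s : ℝ, (((s : ℂ) - Complex.I) ^ (m + 2))⁻¹ = 0 := by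
  have hd (s : ℝ) : HasDerivAt
      (fun s : ℝ => -((m : ℂ) + 1)⁻¹ * (((s : ℂ) - Complex.I) ^ (m + 1))⁻¹)
      ((((s : ℂ) - Complex.I) ^ (m + 2))⁻¹) s := by
    have hne := ofReal_sub_I_ne_zero s
    have hm : (m : ℂ) + 1 ≠ 0 := by exact_mod_cast Nat.succ_ne_zero m
    have h1 : HasDerivAt (fun s : ℝ => (s : ℂ) - Complex.I) 1 s :=
      (Complex.ofRealCLM.hasDerivAt (x := s)).sub_const _
    have h2 := (((h1.fun_pow (m + 1)).fun_inv (pow_ne_zero _ hne)).const_mul (-((m : ℂ) + 1)⁻¹))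
    refine h2.congr_deriv ?_
    push_cast
    field_simp
    simp [pow_succ]
    ring
  have h := integral_of_hasDerivAt_of_tendsto hd (integrable_inv_pow m)
    ((tendsto_inv_pow_zero m tendsto_abs_atBot_atTop).const_mul _)
    ((tendsto_inv_pow_zero m tendsto_abs_atTop_atTop).const_mul _)
  simpa using h

/-- Partial fractions for `1 + s² = (s - i)(s + i)`. The last term integrates to zero, so raising
`m` by one multiplies the integral by `i/2`. -/
lemma kernel_succ (m : ℕ) (s : ℝ) :
    (((1 + s ^ 2 : ℝ) : ℂ))⁻¹ * (((s : ℂ) - Complex.I) ^ (m + 1))⁻¹ =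
      (Complex.I / 2) * ((((1 + s ^ 2 : ℝ) : ℂ))⁻¹ * (((s : ℂ) - Complex.I) ^ m)⁻¹)
        - (Complex.I / 2) * (((s : ℂ) - Complex.I) ^ (m + 2))⁻¹ := by
  have h1 := ofReal_sub_I_ne_zero s
  have h2 : (s : ℂ) + Complex.I ≠ 0 := by
    intro h
    simpa using congrArg Complex.im h
  have h3 : ((1 + s ^ 2 : ℝ) : ℂ) = ((s : ℂ) - Complex.I) * ((s : ℂ) + Complex.I) := by
    push_cast
    linear_combination Complex.I_sq
  have h4 := mul_inv_cancel₀ h1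
  have h5 := mul_inv_cancel₀ h2
  rw [h3, mul_inv, ← inv_pow, ← inv_pow, ← inv_pow]
  generalize ((s : ℂ) - Complex.I)⁻¹ = p at *
  generalize ((s : ℂ) + Complex.I)⁻¹ = q at *
  have key : p * q = Complex.I / 2 * (q - p) := by
    linear_combination (Complex.I / 2 * q) * h4 - (Complex.I / 2 * p) * h5 + p * q * Complex.I_sq
  linear_combination p ^ (m + 1) * key

lemma integral_kernel_ne_zero (m : ℕ) :
    ∫ s : ℝ, (((1 + s ^ 2 : ℝ) : ℂ))⁻¹ * (((s : ℂ) - Complex.I) ^ m)⁻¹ ≠ 0 := by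
  induction m with
  | zero =>
    have h : ∫ s : ℝ, (((1 + s ^ 2 : ℝ) : ℂ))⁻¹ * (((s : ℂ) - Complex.I) ^ 0)⁻¹ =
        ((∫ s : ℝ, (1 + s ^ 2)⁻¹ : ℝ) : ℂ) := by
      rw [← integral_complex_ofReal]
      exact integral_congr_ae (Eventually.of_forall fun s => by simp)
    rw [h, integral_univ_inv_one_add_sq]
    exact_mod_cast Real.pi_ne_zero
  | succ m ih =>
    simp only [kernel_succ]
    rw [integral_sub ((integrable_kernel m).const_mul _) ((integrable_inv_pow m).const_mul _),
      integral_const_mul, integral_const_mul, integral_inv_pow]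
    simpa using ih

/-- If the integrals of `F` against the weights built from `σ = (t - t₀ - iε) r` vanish for small
`ε > 0`, where `r` is bounded below and tends to `1` at the scale `ε` around `t₀`, then
`F t₀ = 0`. -/
theorem eq_zero_of_concentrating_weights {m : ℕ} {ℓ t₀ : ℝ} (ht₀ : t₀ ∈ Ioo 0 ℓ) {F : ℝ → ℂ}
    (hF : ContinuousOn F (Icc 0 ℓ)) {r : ℝ → ℝ → ℂ} {c : ℝ} (hc : 0 < c)
    (hr : ∀ᶠ ε in 𝓝[>] (0 : ℝ), ContinuousOn (r ε) (Icc 0 ℓ))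
    (hrc : ∀ᶠ ε in 𝓝[>] (0 : ℝ), ∀ t ∈ Icc 0 ℓ, c ≤ ‖r ε t‖)
    (hlim : ∀ s : ℝ, Tendsto (fun ε => r ε (t₀ + ε * s)) (𝓝[>] 0) (𝓝 1))
    (hzero : ∀ᶠ ε in 𝓝[>] (0 : ℝ), ∫ t in (0 : ℝ)..ℓ,
      F t * ((‖((((t - t₀ : ℝ) : ℂ) - ε * Complex.I) * r ε t) ^ 2‖⁻¹ : ℝ) : ℂ) *
        (((((t - t₀ : ℝ) : ℂ) - ε * Complex.I) * r ε t) ^ m)⁻¹ = 0) :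
    F t₀ = 0 := by
  have hℓ : 0 < ℓ := ht₀.1.trans ht₀.2
  obtain ⟨B, hB⟩ := isCompact_Icc.exists_bound_of_continuousOn hF
  have hB0 : 0 ≤ B := (norm_nonneg _).trans (hB t₀ ⟨ht₀.1.le, ht₀.2.le⟩)
  set P : ℝ → Set ℝ := fun ε => {s | t₀ + ε * s ∈ Ioc 0 ℓ} with hP
  set Ψ : ℝ → ℝ → ℂ := fun ε s => F (t₀ + ε * s) *
    ((‖(((s : ℂ) - Complex.I) * r ε (t₀ + ε * s)) ^ 2‖⁻¹ : ℝ) : ℂ) *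
    ((((s : ℂ) - Complex.I) * r ε (t₀ + ε * s)) ^ m)⁻¹ with hΨ
  set Φ : ℝ → ℝ → ℂ := fun ε => (P ε).indicator (Ψ ε) with hΦ
  have hPm (ε : ℝ) : MeasurableSet (P ε) :=
    (measurable_const.add (measurable_const.mul measurable_id)) measurableSet_Ioc
  have hpos : ∀ᶠ ε in 𝓝[>] (0 : ℝ), 0 < ε := self_mem_nhdsWithin
  have hPmem (s : ℝ) : ∀ᶠ ε in 𝓝[>] (0 : ℝ), s ∈ P ε := by
    have h : Tendsto (fun ε : ℝ => t₀ + ε * s) (𝓝[>] 0) (𝓝 t₀) := by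
      have : Continuous fun ε : ℝ => t₀ + ε * s := by fun_prop
      simpa using (this.tendsto 0).mono_left nhdsWithin_le_nhds
    exact (h.eventually (Ioo_mem_nhds ht₀.1 ht₀.2)).mono fun ε h => Ioo_subset_Ioc_self h
  have hint : ∀ᶠ ε in 𝓝[>] (0 : ℝ), ∫ s, Φ ε s = 0 := by
    filter_upwards [hzero, hpos] with ε hz hε
    set g : ℝ → ℂ := (Ioc 0 ℓ).indicator fun t =>
      F t * ((‖((((t - t₀ : ℝ) : ℂ) - ε * Complex.I) * r ε t) ^ 2‖⁻¹ : ℝ) : ℂ) *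
        (((((t - t₀ : ℝ) : ℂ) - ε * Complex.I) * r ε t) ^ m)⁻¹ with hg
    have hg0 : ∫ t, g t = 0 := by
      rw [hg, integral_indicator measurableSet_Ioc, ← intervalIntegral.integral_of_le hℓ.le, hz]
    -- Homogeneity: `t - t₀ - iε = ε(s - i)`, so the modulus contributes `ε⁻²` and the power `ε⁻ᵐ`.
    -- The half-open `Ioc` is the domain of the interval integral.
    have hΦg (s : ℝ) : Φ ε s = (ε : ℂ) ^ (m + 2) * g (t₀ + ε * s) := by
      by_cases hs : t₀ + ε * s ∈ Ioc 0 ℓ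
      · rw [hΦ, hg]
        simp only
        rw [indicator_of_mem (show s ∈ P ε from hs), indicator_of_mem hs, hΨ]
        have h1 : (((t₀ + ε * s - t₀ : ℝ) : ℂ) - ε * Complex.I) = ε * ((s : ℂ) - Complex.I) := by
          push_cast; ring
        have hε' : (ε : ℂ) ≠ 0 := by exact_mod_cast hε.ne'
        simp only [h1]
        rw [mul_assoc (ε : ℂ), mul_pow (ε : ℂ) _ 2, norm_mul, norm_pow (ε : ℂ), Complex.norm_real,
          Real.norm_of_nonneg hε.le, mul_pow (ε : ℂ) _ m, mul_inv, mul_inv, pow_add]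
        push_cast
        have e1 : (ε : ℂ) ^ m * ((ε : ℂ) ^ m)⁻¹ = 1 := mul_inv_cancel₀ (pow_ne_zero _ hε')
        have e2 : (ε : ℂ) ^ 2 * ((ε : ℂ) ^ 2)⁻¹ = 1 := mul_inv_cancel₀ (pow_ne_zero _ hε')
        generalize ((ε : ℂ) ^ m)⁻¹ = p at *
        generalize ((ε : ℂ) ^ 2)⁻¹ = q at *
        generalize (((((s : ℂ) - Complex.I) * r ε (t₀ + ε * s)) ^ m)⁻¹) = x
        generalize (((‖(((s : ℂ) - Complex.I) * r ε (t₀ + ε * s)) ^ 2‖ : ℝ) : ℂ)⁻¹) = y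
        linear_combination (-F (t₀ + ε * s) * y * x) * (e1 * (ε : ℂ) ^ 2 * q + e2)
      · rw [hΦ, hg]
        simp only
        rw [indicator_of_notMem (show s ∉ P ε from hs), indicator_of_notMem hs, mul_zero]
    simp only [hΦg]
    rw [integral_const_mul, Measure.integral_comp_mul_left (fun t => g (t₀ + t)) ε,
      integral_add_left_eq_self, hg0]
    simp
  have hlimΦ : Tendsto (fun ε => ∫ s, Φ ε s) (𝓝[>] 0)
      (𝓝 (∫ s : ℝ, F t₀ * ((((1 + s ^ 2 : ℝ) : ℂ))⁻¹ * (((s : ℂ) - Complex.I) ^ m)⁻¹))) := by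
    -- The majorant uses `‖F‖ ≤ B`, `‖r‖ ≥ c` and `|s - i|ᵐ ≥ 1`; the decay comes from `|s - i|² = 1
    -- + s²`.
    refine tendsto_integral_filter_of_dominated_convergence
      (fun s => B * (c ^ 2)⁻¹ * (c ^ m)⁻¹ * (1 + s ^ 2)⁻¹) ?_ ?_
      (integrable_inv_one_add_sq.const_mul _) (Eventually.of_forall fun s => ?_)
    · filter_upwards [hr, hrc] with ε hε hεc
      rw [hΦ]
      refine (aestronglyMeasurable_indicator_iff (hPm ε)).2
        (ContinuousOn.aestronglyMeasurable ?_ (hPm ε))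
      have hm : MapsTo (fun s : ℝ => t₀ + ε * s) (P ε) (Icc 0 ℓ) := fun s hs =>
        Ioc_subset_Icc_self hs
      have haff : ContinuousOn (fun s : ℝ => t₀ + ε * s) (P ε) := by fun_prop
      have hσ : ContinuousOn (fun s : ℝ => ((s : ℂ) - Complex.I) * r ε (t₀ + ε * s)) (P ε) :=
        ContinuousOn.mul (by fun_prop) (hε.comp haff hm)
      have hne : ∀ s ∈ P ε, ((s : ℂ) - Complex.I) * r ε (t₀ + ε * s) ≠ 0 := fun s hs =>
        mul_ne_zero (ofReal_sub_I_ne_zero s)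
          (norm_pos_iff.1 (hc.trans_le (hεc _ (hm hs))))
      refine ((hF.comp haff hm).mul (Complex.continuous_ofReal.comp_continuousOn
        ((hσ.pow 2).norm.inv₀ fun s hs => ?_))).mul ((hσ.pow m).inv₀ fun s hs => ?_)
      · exact norm_ne_zero_iff.2 (pow_ne_zero _ (hne s hs))
      · exact pow_ne_zero _ (hne s hs)
    · filter_upwards [hrc] with ε hεc
      refine Eventually.of_forall fun s => ?_
      by_cases hs : s ∈ P ε
      · have ht : t₀ + ε * s ∈ Icc 0 ℓ := Ioc_subset_Icc_self hs
        simp only [hΦ]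
        rw [indicator_of_mem hs]
        simp only [hΨ, norm_mul, norm_inv, norm_pow, Complex.norm_real, norm_norm, mul_pow,
          norm_ofReal_sub_I_sq]
        rw [Real.norm_of_nonneg (by positivity : (0 : ℝ) ≤ 1 + s ^ 2)]
        have h1 := hB _ ht
        have h2 := hεc _ ht
        have h3 := one_le_pow₀ (n := m) (one_le_norm_ofReal_sub_I s)
        have h4 : c ^ m ≤ ‖(s : ℂ) - Complex.I‖ ^ m * ‖r ε (t₀ + ε * s)‖ ^ m :=
          (pow_le_pow_left₀ hc.le h2 m).trans (le_mul_of_one_le_left (by positivity) h3)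
        have h5 : c ^ 2 * (1 + s ^ 2) ≤ (1 + s ^ 2) * ‖r ε (t₀ + ε * s)‖ ^ 2 := by
          rw [mul_comm]
          gcongr
        calc _ ≤ B * (c ^ 2 * (1 + s ^ 2))⁻¹ * (c ^ m)⁻¹ := by gcongr
          _ = _ := by rw [mul_inv]; ring
      · simp only [hΦ]
        rw [indicator_of_notMem hs, norm_zero]
        positivity
    · have hΨlim : Tendsto (fun ε => Ψ ε s) (𝓝[>] 0) (𝓝 (F t₀ *
          ((‖(((s : ℂ) - Complex.I) * 1) ^ 2‖⁻¹ : ℝ) : ℂ) *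
          ((((s : ℂ) - Complex.I) * 1) ^ m)⁻¹)) := by
        have hne : ((s : ℂ) - Complex.I) * 1 ≠ 0 := by simpa using ofReal_sub_I_ne_zero s
        have hσ := (hlim s).const_mul ((s : ℂ) - Complex.I)
        have hFt : Tendsto (fun ε : ℝ => F (t₀ + ε * s)) (𝓝[>] 0) (𝓝 (F t₀)) := by
          have h : Tendsto (fun ε : ℝ => t₀ + ε * s) (𝓝[>] 0) (𝓝 t₀) := by
            have : Continuous fun ε : ℝ => t₀ + ε * s := by fun_prop
            simpa using (this.tendsto 0).mono_left nhdsWithin_le_nhds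
          exact (hF.continuousAt (Icc_mem_nhds ht₀.1 ht₀.2)).tendsto.comp h
        refine (hFt.mul ((Complex.continuous_ofReal.tendsto _).comp
          ((hσ.pow 2).norm.inv₀ ?_))).mul ((hσ.pow m).inv₀ ?_)
        · exact norm_ne_zero_iff.2 (pow_ne_zero _ hne)
        · exact pow_ne_zero _ hne
      rw [mul_one, norm_pow, norm_ofReal_sub_I_sq, Complex.ofReal_inv, mul_assoc] at hΨlim
      refine hΨlim.congr' ((hPmem s).mono fun ε hε => ?_)
      simp only [hΦ]
      rw [indicator_of_mem hε]
  have h0 := tendsto_nhds_unique hlimΦ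
    ((tendsto_const_nhds (x := (0 : ℂ))).congr' (hint.mono fun ε h => h.symm))
  rw [integral_const_mul] at h0
  exact (mul_eq_zero.1 h0).resolve_right (integral_kernel_ne_zero m)

/-! ### Linear differential equations -/

section LinearODE

variable {E : Type*} [NormedAddCommGroup E] [NormedSpace ℝ E]

/-- The terms of the Peano–Baker series. -/
def peanoBaker (A : ℝ → E →L[ℝ] E) (t₀ : ℝ) (x₀ : E) : ℕ → ℝ → E
  | 0 => fun _ => x₀
  | n + 1 => fun t => ∫ s in t₀..t, A s (peanoBaker A t₀ x₀ n s)

variable {A : ℝ → E →L[ℝ] E}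

lemma continuous_peanoBaker (hA : Continuous A) (t₀ : ℝ) (x₀ : E) (n : ℕ) :
    Continuous (peanoBaker A t₀ x₀ n) := by
  induction n with
  | zero => exact continuous_const
  | succ n ih =>
    have h : Continuous fun s => A s (peanoBaker A t₀ x₀ n s) := hA.clm_apply ih
    exact intervalIntegral.continuous_primitive (fun a b => h.intervalIntegrable a b) t₀

/-- Integrating `|s - t₀|ⁿ` once per step produces the factorial, so the series is dominated by an
exponential series. -/
lemma norm_peanoBaker_le {C : ℝ} (hA : Continuous A) (hC : ∀ t, ‖A t‖ ≤ C) (t₀ : ℝ) (x₀ : E)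
    (n : ℕ) (t : ℝ) :
    ‖peanoBaker A t₀ x₀ n t‖ ≤ ‖x₀‖ * ((C * |t - t₀|) ^ n / n.factorial) := by
  have hC0 : 0 ≤ C := (norm_nonneg _).trans (hC 0)
  induction n generalizing t with
  | zero => simp [peanoBaker]
  | succ n ih =>
    have hcont : Continuous fun s => A s (peanoBaker A t₀ x₀ n s) :=
      hA.clm_apply (continuous_peanoBaker hA t₀ x₀ n)
    calc ‖peanoBaker A t₀ x₀ (n + 1) t‖
        ≤ ∫ s in uIoc t₀ t, ‖A s (peanoBaker A t₀ x₀ n s)‖ :=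
          intervalIntegral.norm_integral_le_integral_norm_uIoc
      _ ≤ ∫ s in uIoc t₀ t, (‖x₀‖ * C ^ (n + 1) / n.factorial) * |s - t₀| ^ n := by
          refine setIntegral_mono_on ?_ ?_ measurableSet_uIoc fun s _ => ?_
          · exact (hcont.norm.intervalIntegrable t₀ t).def'
          · exact (Continuous.intervalIntegrable (by fun_prop) t₀ t).def'
          · calc ‖A s (peanoBaker A t₀ x₀ n s)‖
                ≤ C * (‖x₀‖ * ((C * |s - t₀|) ^ n / n.factorial)) :=
                  (A s).le_of_opNorm_le_of_le (hC s) (ih s)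
              _ = _ := by rw [mul_pow]; ring
      _ = ‖x₀‖ * ((C * |t - t₀|) ^ (n + 1) / (n + 1).factorial) := by
          rw [integral_const_mul, integral_pow_abs_sub_uIoc, mul_pow,
            Nat.factorial_succ]
          push_cast
          field_simp

variable [CompleteSpace E]

lemma hasDerivAt_peanoBaker_succ (hA : Continuous A) (t₀ : ℝ) (x₀ : E) (n : ℕ) (t : ℝ) :
    HasDerivAt (peanoBaker A t₀ x₀ (n + 1)) (A t (peanoBaker A t₀ x₀ n t)) t :=
  ((hA.clm_apply (continuous_peanoBaker hA t₀ x₀ n)).integral_hasStrictDerivAt t₀ t).hasDerivAt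

/-- Global existence for linear differential equations with bounded continuous coefficients. -/
theorem exists_hasDerivAt_linear (hA : Continuous A) {C : ℝ} (hC : ∀ t, ‖A t‖ ≤ C) (t₀ : ℝ)
    (x₀ : E) : ∃ x : ℝ → E, x t₀ = x₀ ∧ ∀ t, HasDerivAt x (A t (x t)) t := by
  have hC0 : 0 ≤ C := (norm_nonneg _).trans (hC 0)
  have hsum (t : ℝ) : Summable fun n => peanoBaker A t₀ x₀ n t :=
    Summable.of_norm_bounded ((Real.summable_pow_div_factorial _).mul_left _)
      fun n => norm_peanoBaker_le hA hC t₀ x₀ n t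
  have hsplit (t : ℝ) : ∑' n, peanoBaker A t₀ x₀ n t =
      x₀ + ∑' n, peanoBaker A t₀ x₀ (n + 1) t := (hsum t).tsum_eq_zero_add
  refine ⟨fun t => ∑' n, peanoBaker A t₀ x₀ n t, ?_, fun t => ?_⟩
  · change ∑' n, peanoBaker A t₀ x₀ n t₀ = x₀
    rw [hsplit]
    simp [peanoBaker]
  -- The series is differentiated termwise on a ball containing `t`, where the derivatives have a
  -- summable uniform bound. The shift of index turns the derivative of the tail into `A` applied to
  -- the full series.
  · set R := |t - t₀| + 1 with hR
    have hmem : t ∈ Metric.ball t₀ R := by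
      rw [Metric.mem_ball, Real.dist_eq, hR]; linarith
    have h := hasDerivAt_tsum_of_isPreconnected
      (u := fun n : ℕ => C * (‖x₀‖ * ((C * R) ^ n / n.factorial)))
      (g := fun n => peanoBaker A t₀ x₀ (n + 1))
      (g' := fun n t => A t (peanoBaker A t₀ x₀ n t))
      (((Real.summable_pow_div_factorial _).mul_left _).mul_left _)
      (Metric.isOpen_ball (x := t₀) (ε := R)) (convex_ball t₀ R).isPreconnected
      (fun n y _ => hasDerivAt_peanoBaker_succ hA t₀ x₀ n y)
      (fun n y hy => ?_) hmem ((summable_nat_add_iff 1).2 (hsum t)) hmem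
    · simp only [hsplit]
      refine (h.const_add x₀).congr_deriv ?_
      rw [← (A t).map_tsum (hsum t), hsplit]
    · refine (A y).le_of_opNorm_le_of_le (hC y) ((norm_peanoBaker_le hA hC t₀ x₀ n y).trans ?_)
      have : |y - t₀| ≤ R := by
        rw [Metric.mem_ball, Real.dist_eq] at hy; exact hy.le
      gcongr

end LinearODE

/-! ### Matrix solutions of the Jacobi equation -/

/-- `X` solves `X'' + K X = 0` on the real line, with derivative `X'`. -/
def IsJacobiSol (K X X' : ℝ → Matrix (Fin 2) (Fin 2) ℝ) : Prop :=
  (∀ t a b, HasDerivAt (fun s => X s a b) (X' t a b) t) ∧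
    ∀ t a b, HasDerivAt (fun s => X' s a b) (-((K t * X t) a b)) t

/-- The generator `(X, X') ↦ (X', -K X)` of the first order system. -/
def jacobiGenerator (K : Matrix (Fin 2) (Fin 2) ℝ) :
    (Fin 2 → Fin 2 → ℝ) × (Fin 2 → Fin 2 → ℝ) →L[ℝ]
      (Fin 2 → Fin 2 → ℝ) × (Fin 2 → Fin 2 → ℝ) :=
  LinearMap.toContinuousLinearMap
    { toFun := fun x => (x.2, fun a b => -∑ c, K a c * x.1 c b)
      map_add' := fun x y => by
        refine Prod.ext rfl (funext fun a => funext fun b => ?_)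
        change -∑ c, K a c * (x.1 c b + y.1 c b) =
          -∑ c, K a c * x.1 c b + -∑ c, K a c * y.1 c b
        simp only [mul_add, Finset.sum_add_distrib]
        ring
      map_smul' := fun r x => by
        refine Prod.ext rfl (funext fun a => funext fun b => ?_)
        change -∑ c, K a c * (r * x.1 c b) = r * -∑ c, K a c * x.1 c b
        rw [mul_neg, Finset.mul_sum]
        exact congrArg _ (Finset.sum_congr rfl fun c _ => by ring) }

lemma jacobiGenerator_apply (K : Matrix (Fin 2) (Fin 2) ℝ)
    (x : (Fin 2 → Fin 2 → ℝ) × (Fin 2 → Fin 2 → ℝ)) :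
    jacobiGenerator K x = (x.2, fun a b => -∑ c, K a c * x.1 c b) := rfl

/-- Since `K` factors through the projection to a compact interval, the generator is bounded on the
whole line. -/
theorem exists_isJacobiSol {K : ℝ → Matrix (Fin 2) (Fin 2) ℝ} (hK : Continuous K) {l : ℝ}
    (hl : 0 ≤ l) (hKl : ∀ t, K t = K (projIcc 0 l hl t)) (t₀ : ℝ)
    (X₀ X₁ : Matrix (Fin 2) (Fin 2) ℝ) :
    ∃ X X', IsJacobiSol K X X' ∧ X t₀ = X₀ ∧ X' t₀ = X₁ := by
  have hA : Continuous fun t => jacobiGenerator (K t) := by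
    refine continuous_clm_apply.2 fun x => ?_
    simp only [jacobiGenerator_apply]
    fun_prop
  obtain ⟨C, hC⟩ := (isCompact_Icc (a := (0 : ℝ)) (b := l)).exists_bound_of_continuousOn
    hA.continuousOn
  have hC' (t : ℝ) : ‖jacobiGenerator (K t)‖ ≤ C := by
    rw [hKl]
    exact hC _ (projIcc 0 l hl t).2
  obtain ⟨x, hx0, hx⟩ := exists_hasDerivAt_linear hA hC' t₀
    ((X₀, X₁) : (Fin 2 → Fin 2 → ℝ) × (Fin 2 → Fin 2 → ℝ))
  refine ⟨fun t => (x t).1, fun t => (x t).2, ⟨fun t a b => ?_, fun t a b => ?_⟩, ?_, ?_⟩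
  · exact hasDerivAt_pi.1 (hasDerivAt_pi.1
      ((ContinuousLinearMap.fst ℝ _ _).hasFDerivAt.comp_hasDerivAt t (hx t)) a) b
  · exact hasDerivAt_pi.1 (hasDerivAt_pi.1
      ((ContinuousLinearMap.snd ℝ _ _).hasFDerivAt.comp_hasDerivAt t (hx t)) a) b
  · simp [hx0]
  · simp [hx0]

/-! ### Complex Lagrangian data -/

section LagrangianData

open Matrix
open scoped ComplexOrder

lemma conjTranspose_map_ofReal (A : Matrix (Fin 2) (Fin 2) ℝ) :
    (A.map ((↑) : ℝ → ℂ))ᴴ = (A.map ((↑) : ℝ → ℂ))ᵀ := by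
  ext i j
  simp

lemma map_ofReal_mul (A B : Matrix (Fin 2) (Fin 2) ℝ) :
    (A * B).map ((↑) : ℝ → ℂ) = A.map ((↑) : ℝ → ℂ) * B.map ((↑) : ℝ → ℂ) :=
  Matrix.map_mul (f := Complex.ofRealHom)

/-- The combination `D - iε C` of real matrices. -/
def complexCombination (ε : ℝ) (C D : Matrix (Fin 2) (Fin 2) ℝ) : Matrix (Fin 2) (Fin 2) ℂ :=
  D.map ((↑) : ℝ → ℂ) - (ε * Complex.I) • C.map ((↑) : ℝ → ℂ)

variable {C C' D D' : Matrix (Fin 2) (Fin 2) ℝ} (ε : ℝ)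

lemma wronskian_map_ofReal {A A' B B' : Matrix (Fin 2) (Fin 2) ℝ} {r : ℝ}
    (h : Aᵀ * B' - A'ᵀ * B = r • (1 : Matrix (Fin 2) (Fin 2) ℝ)) :
    (A.map ((↑) : ℝ → ℂ))ᵀ * B'.map ((↑) : ℝ → ℂ) =
      (A'.map ((↑) : ℝ → ℂ))ᵀ * B.map ((↑) : ℝ → ℂ)
        + (r : ℂ) • (1 : Matrix (Fin 2) (Fin 2) ℂ) := by
  rw [← Matrix.transpose_map, ← Matrix.transpose_map, ← map_ofReal_mul, ← map_ofReal_mul,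
    sub_eq_iff_eq_add'.1 h]
  ext i j
  simp [Matrix.one_apply]
  split_ifs <;> simp

/-- The two cross Wronskians have opposite signs and cancel in the bilinear pairing. -/
lemma complexCombination_lagrangian (hD : Dᵀ * D' - D'ᵀ * D = (0 : ℝ) • 1)
    (hC : Cᵀ * C' - C'ᵀ * C = (0 : ℝ) • 1) (hCD : Cᵀ * D' - C'ᵀ * D = (1 : ℝ) • 1)
    (hDC : Dᵀ * C' - D'ᵀ * C = (-1 : ℝ) • 1) :
    (complexCombination ε C D)ᵀ * complexCombination ε C' D' =
      (complexCombination ε C' D')ᵀ * complexCombination ε C D := by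
  simp only [complexCombination, transpose_sub, transpose_smul, sub_mul, mul_sub, smul_mul_assoc,
    mul_smul_comm, wronskian_map_ofReal hD, wronskian_map_ofReal hC, wronskian_map_ofReal hCD,
    wronskian_map_ofReal hDC]
  push_cast
  module

/-- Conjugation flips the sign of one `iε`, so the cross Wronskians now add up to `2iε`. -/
lemma complexCombination_positive (hD : Dᵀ * D' - D'ᵀ * D = (0 : ℝ) • 1)
    (hC : Cᵀ * C' - C'ᵀ * C = (0 : ℝ) • 1) (hCD : Cᵀ * D' - C'ᵀ * D = (1 : ℝ) • 1)
    (hDC : Dᵀ * C' - D'ᵀ * C = (-1 : ℝ) • 1) :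
    (complexCombination ε C D)ᴴ * complexCombination ε C' D' =
      (complexCombination ε C' D')ᴴ * complexCombination ε C D
        + (2 * ε * Complex.I) • (1 : Matrix (Fin 2) (Fin 2) ℂ) := by
  have hs : star ((ε : ℂ) * Complex.I) = -(ε * Complex.I) := by simp
  simp only [complexCombination, conjTranspose_sub, conjTranspose_smul, conjTranspose_map_ofReal,
    hs, sub_mul, mul_sub, smul_mul_assoc,
    mul_smul_comm, wronskian_map_ofReal hD, wronskian_map_ofReal hC, wronskian_map_ofReal hCD,
    wronskian_map_ofReal hDC]
  push_cast
  module

lemma isSymm_mul_inv {Z Z' : Matrix (Fin 2) (Fin 2) ℂ} (hZ : IsUnit Z.det)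
    (h : Zᵀ * Z' = Z'ᵀ * Z) : (Z' * Z⁻¹).IsSymm := by
  have hZT : IsUnit Zᵀ.det := by rwa [det_transpose]
  rw [Matrix.IsSymm, transpose_mul, transpose_nonsing_inv]
  calc Zᵀ⁻¹ * Z'ᵀ = Zᵀ⁻¹ * (Z'ᵀ * Z) * Z⁻¹ := by
        rw [mul_assoc, mul_assoc, mul_nonsing_inv _ hZ, mul_one]
    _ = Z' * Z⁻¹ := by rw [← h, ← mul_assoc, nonsing_inv_mul _ hZT, one_mul]

lemma posDef_im_mul_inv {Z Z' : Matrix (Fin 2) (Fin 2) ℂ} (hZ : IsUnit Z.det) (hε : 0 < ε)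
    (hsymm : (Z' * Z⁻¹).IsSymm)
    (h : Zᴴ * Z' = Z'ᴴ * Z + (2 * ε * Complex.I) • (1 : Matrix (Fin 2) (Fin 2) ℂ)) :
    ((Z' * Z⁻¹).map Complex.im).PosDef := by
  set N := Z⁻¹ with hN
  have hZN : Z * N = 1 := mul_nonsing_inv _ hZ
  have hNZ : Nᴴ * Zᴴ = 1 := by rw [← conjTranspose_mul, hZN, conjTranspose_one]
  have h1 : Z' * N - (Z' * N)ᴴ = (2 * ε * Complex.I) • (Nᴴ * N) := by
    calc Z' * N - (Z' * N)ᴴ = Nᴴ * (Zᴴ * Z') * N - Nᴴ * (Z'ᴴ * Z) * N := by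
          rw [conjTranspose_mul, ← mul_assoc Nᴴ, hNZ, one_mul, mul_assoc Nᴴ, mul_assoc Z'ᴴ, hZN,
            mul_one]
      _ = _ := by
          rw [h, mul_add, add_mul]
          simp
  -- For a symmetric matrix `H`, `H - Hᴴ` is entrywise `2i Im H`; this identifies the imaginary part
  -- with a multiple of the Gram matrix `Nᴴ N`.
  have h2 : ((Z' * N).map Complex.im).map ((↑) : ℝ → ℂ) = (ε : ℂ) • (Nᴴ * N) := by
    ext i j
    have h3 := congrFun (congrFun h1 i) j
    have h4 : (Z' * N) j i = (Z' * N) i j := hsymm.apply i j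
    rw [Matrix.sub_apply, conjTranspose_apply, h4, Matrix.smul_apply] at h3
    have h5 := Complex.sub_conj ((Z' * N) i j)
    rw [← starRingEnd_apply, h5] at h3
    simp only [Matrix.map_apply, Matrix.smul_apply, smul_eq_mul] at h3 ⊢
    have hI : (2 * Complex.I) ≠ 0 := by simp
    apply mul_left_cancel₀ hI
    push_cast at h3
    linear_combination h3
  refine PosDef.of_dotProduct_mulVec_pos ?_ fun x hx => ?_
  · rw [Matrix.IsHermitian, conjTranspose_eq_transpose_of_trivial, ← transpose_map, hsymm.eq]
  · set xc : Fin 2 → ℂ := fun i => (x i : ℂ) with hxc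
    have hNx : N *ᵥ xc ≠ 0 := by
      intro h0
      apply hx
      have : xc = 0 := by
        rw [← one_mulVec xc, ← hZN, ← mulVec_mulVec, h0, mulVec_zero]
      funext i
      have hi : (x i : ℂ) = 0 := congrFun this i
      exact_mod_cast hi
    have h6 : (((star x ⬝ᵥ ((Z' * N).map Complex.im *ᵥ x) : ℝ)) : ℂ) =
        (ε : ℂ) * (star (N *ᵥ xc) ⬝ᵥ (N *ᵥ xc)) := by
      have h7 : (((star x ⬝ᵥ ((Z' * N).map Complex.im *ᵥ x) : ℝ)) : ℂ) =
          star xc ⬝ᵥ (((Z' * N).map Complex.im).map ((↑) : ℝ → ℂ) *ᵥ xc) := by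
        simp [dotProduct, mulVec, hxc]
      rw [h7, h2, smul_mulVec, dotProduct_smul, smul_eq_mul, star_mulVec, ← mulVec_mulVec,
        dotProduct_mulVec]
    have h8 : (0 : ℂ) < (ε : ℂ) * (star (N *ᵥ xc) ⬝ᵥ (N *ᵥ xc)) :=
      mul_pos (by exact_mod_cast hε) (dotProduct_star_self_pos_iff.2 hNx)
    rw [← h6] at h8
    exact_mod_cast h8

/-- The Wronskian of two solutions is constant. -/
lemma wronskian_eq {K X X' Y Y' : ℝ → Matrix (Fin 2) (Fin 2) ℝ} (hK : ∀ t, (K t).IsSymm)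
    (hX : IsJacobiSol K X X') (hY : IsJacobiSol K Y Y') (s t : ℝ) :
    (X s)ᵀ * Y' s - (X' s)ᵀ * Y s = (X t)ᵀ * Y' t - (X' t)ᵀ * Y t := by
  ext a b
  have hd (r : ℝ) : HasDerivAt (fun r => ∑ c, (X r c a * Y' r c b - X' r c a * Y r c b)) 0 r := by
    have h := HasDerivAt.fun_sum (u := Finset.univ) fun (c : Fin 2) _ =>
      ((hX.1 r c a).mul (hY.2 r c b)).sub ((hX.2 r c a).mul (hY.1 r c b))
    refine h.congr_deriv ?_
    have h01 : K r 1 0 = K r 0 1 := (hK r).apply 0 1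
    simp only [Fin.sum_univ_two, mul_apply, h01]
    ring
  have h := is_const_of_deriv_eq_zero (fun r => (hd r).differentiableAt) (fun r => (hd r).deriv)
    s t
  simpa [mul_apply] using h

end LagrangianData

/-! ### The rescaled determinant -/

section Determinant

variable {ℓ t₀ : ℝ}

/-- The ratio `iε / (t - t₀ - iε)`. -/
def ratio (t₀ ε t : ℝ) : ℂ := (ε * Complex.I) / (((t - t₀ : ℝ) : ℂ) - ε * Complex.I)

lemma sub_mul_I_ne_zero {ε : ℝ} (hε : 0 < ε) (τ : ℝ) : (τ : ℂ) - ε * Complex.I ≠ 0 := by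
  intro h
  have := congrArg Complex.im h
  simp at this
  exact hε.ne' this

lemma norm_ratio_le_one {ε : ℝ} (hε : 0 < ε) (t : ℝ) : ‖ratio t₀ ε t‖ ≤ 1 := by
  rw [ratio, norm_div, div_le_one (norm_pos_iff.2 (sub_mul_I_ne_zero hε _))]
  have h := Complex.abs_im_le_norm (((t - t₀ : ℝ) : ℂ) - ε * Complex.I)
  simpa using h

lemma norm_ratio_le_div {ε δ : ℝ} (hε : 0 < ε) (hδ : 0 < δ) {t : ℝ} (ht : δ ≤ |t - t₀|) :
    ‖ratio t₀ ε t‖ ≤ ε / δ := by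
  rw [ratio, norm_div]
  have h := Complex.abs_re_le_norm (((t - t₀ : ℝ) : ℂ) - ε * Complex.I)
  have h1 : |t - t₀| ≤ ‖((t - t₀ : ℝ) : ℂ) - ε * Complex.I‖ := by simpa using h
  have h2 : ‖(ε : ℂ) * Complex.I‖ = ε := by simp [abs_of_pos hε]
  rw [h2]
  gcongr
  exact ht.trans h1

/-- The perturbation `d - w b + w² p` of `d` with `w` the ratio. -/
def perturbedDet (t₀ : ℝ) (d b p : ℝ → ℝ) (ε t : ℝ) : ℂ :=
  d t - ratio t₀ ε t * b t + ratio t₀ ε t ^ 2 * p t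

variable {d b p : ℝ → ℝ}

lemma norm_perturbedDet_sub_le {ε : ℝ} (hε : 0 < ε) (t : ℝ) :
    ‖perturbedDet t₀ d b p ε t - d t‖ ≤ ‖ratio t₀ ε t‖ * (|b t| + |p t|) := by
  have h : perturbedDet t₀ d b p ε t - d t =
      ratio t₀ ε t * (-(b t : ℂ) + ratio t₀ ε t * p t) := by
    rw [perturbedDet]; ring
  rw [h, norm_mul]
  gcongr
  refine (norm_add_le _ _).trans ?_
  rw [norm_neg, norm_mul, Complex.norm_real, Complex.norm_real, Real.norm_eq_abs, Real.norm_eq_abs]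
  have := mul_le_of_le_one_left (abs_nonneg (p t)) (norm_ratio_le_one (t₀ := t₀) hε t)
  linarith

lemma continuous_perturbedDet (hd : Continuous d) (hb : Continuous b) (hp : Continuous p)
    {ε : ℝ} (hε : 0 < ε) : Continuous (perturbedDet t₀ d b p ε) := by
  have hw : Continuous (ratio t₀ ε) :=
    Continuous.div (by fun_prop) (by fun_prop) fun t => sub_mul_I_ne_zero hε _
  unfold perturbedDet
  fun_prop

/-- Keeps the values off the branch cut of the principal root, uniformly on `[0, ℓ]`. -/
lemma eventually_re_perturbedDet (hb : Continuous b) (hp : Continuous p)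
    (hb0 : b t₀ = 0) (hp0 : p t₀ = 0) {c : ℝ} (hc : 0 < c) (hdc : ∀ t ∈ Icc 0 ℓ, c ≤ d t) :
    ∀ᶠ ε in 𝓝[>] (0 : ℝ), ∀ t ∈ Icc 0 ℓ, c / 2 ≤ (perturbedDet t₀ d b p ε t).re := by
  have hq : Continuous fun t => |b t| + |p t| := by fun_prop
  obtain ⟨Q, hQ⟩ := (isCompact_Icc (a := (0 : ℝ)) (b := ℓ)).exists_bound_of_continuousOn
    hq.continuousOn
  obtain ⟨δ, hδ, hδq⟩ := Metric.continuousAt_iff.1 (hq.continuousAt (x := t₀)) (c / 2)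
    (by positivity)
  have hev : ∀ᶠ ε in 𝓝[>] (0 : ℝ), ε / δ * (|Q| + 1) < c / 2 := by
    have h : Continuous fun ε : ℝ => ε / δ * (|Q| + 1) := by fun_prop
    have h0 : Tendsto (fun ε : ℝ => ε / δ * (|Q| + 1)) (𝓝[>] 0) (𝓝 0) := by
      simpa using (h.tendsto 0).mono_left nhdsWithin_le_nhds
    exact h0.eventually (gt_mem_nhds (by positivity))
  filter_upwards [hev, self_mem_nhdsWithin] with ε hε1 hε t ht
  have hε0 : (0 : ℝ) < ε := hε
  have hdiff : ‖perturbedDet t₀ d b p ε t - d t‖ ≤ c / 2 := by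
    refine (norm_perturbedDet_sub_le hε0 t).trans ?_
    have hn : 0 ≤ |b t| + |p t| := by positivity
    -- Near `t₀` the ratio is only bounded by `1`, but `b` and `p` are small; away from `t₀` the
    -- ratio itself is at most `ε / δ`.
    by_cases hcase : |t - t₀| < δ
    · have h1 := hδq (x := t) (by rwa [Real.dist_eq])
      rw [Real.dist_eq, hb0, hp0, abs_zero, add_zero, sub_zero, abs_of_nonneg hn] at h1
      exact (mul_le_of_le_one_left hn (norm_ratio_le_one hε0 t)).trans h1.le
    · have h2 := hQ t ht
      rw [Real.norm_of_nonneg hn] at h2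
      calc _ ≤ ε / δ * (|Q| + 1) := by
            have h3 : |b t| + |p t| ≤ |Q| + 1 := h2.trans ((le_abs_self Q).trans (by linarith))
            exact mul_le_mul (norm_ratio_le_div hε0 hδ (not_lt.1 hcase)) h3 hn (by positivity)
        _ ≤ c / 2 := hε1.le
  have h3 := (Complex.abs_re_le_norm (perturbedDet t₀ d b p ε t - d t)).trans hdiff
  rw [Complex.sub_re, Complex.ofReal_re, abs_le] at h3
  linarith [hdc t ht, h3.1]

/-- At this scale the ratio equals `i / (s - i)` and does not decay; the limit relies on `b` and `p`
vanishing at `t₀`. -/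
lemma tendsto_perturbedDet (hd : Continuous d) (hb : Continuous b) (hp : Continuous p)
    (hd0 : d t₀ = 1) (hb0 : b t₀ = 0) (hp0 : p t₀ = 0) (s : ℝ) :
    Tendsto (fun ε => perturbedDet t₀ d b p ε (t₀ + ε * s)) (𝓝[>] 0) (𝓝 1) := by
  have ht : Tendsto (fun ε : ℝ => t₀ + ε * s) (𝓝[>] 0) (𝓝 t₀) := by
    have : Continuous fun ε : ℝ => t₀ + ε * s := by fun_prop
    simpa using (this.tendsto 0).mono_left nhdsWithin_le_nhds
  have h1 : Tendsto (fun ε : ℝ => perturbedDet t₀ d b p ε (t₀ + ε * s) - d (t₀ + ε * s)) (𝓝[>] 0)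
      (𝓝 0) := by
    have hq : Tendsto (fun ε : ℝ => |b (t₀ + ε * s)| + |p (t₀ + ε * s)|) (𝓝[>] 0) (𝓝 0) := by
      have h : Continuous fun t => |b t| + |p t| := by fun_prop
      simpa [hb0, hp0, Function.comp_def] using (h.tendsto t₀).comp ht
    refine squeeze_zero_norm' ?_ hq
    filter_upwards [self_mem_nhdsWithin] with ε hε
    exact (norm_perturbedDet_sub_le hε _).trans
      (mul_le_of_le_one_left (by positivity) (norm_ratio_le_one hε _))
  have h2 : Tendsto (fun ε : ℝ => (d (t₀ + ε * s) : ℂ)) (𝓝[>] 0) (𝓝 1) := by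
    have := ((Complex.continuous_ofReal.comp hd).tendsto t₀).comp ht
    simpa [hd0, Function.comp_def] using this
  simpa using h1.add h2

end Determinant

/-! ### The complex Jacobi solutions concentrating at a point -/

section Concentration

variable {K C C' D D' : ℝ → Matrix (Fin 2) (Fin 2) ℝ} {t₀ : ℝ}

/-- The difference quotient `D(t) / (t - t₀)`, extended continuously. -/
def quotientMatrix (D : ℝ → Matrix (Fin 2) (Fin 2) ℝ) (t₀ t : ℝ) : Matrix (Fin 2) (Fin 2) ℝ :=
  Matrix.of fun a b => dslope (fun s => D s a b) t₀ t

lemma continuous_quotientMatrix (hD : IsJacobiSol K D D') (a b : Fin 2) :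
    Continuous fun t => quotientMatrix D t₀ t a b := by
  have hd : Differentiable ℝ fun s => D s a b := fun t => (hD.1 t a b).differentiableAt
  exact continuousOn_univ.1 ((continuousOn_dslope univ_mem).2 ⟨hd.continuous.continuousOn, hd t₀⟩)

lemma sub_mul_quotientMatrix (hD0 : D t₀ = 0) (t : ℝ) (a b : Fin 2) :
    D t a b = (t - t₀) * quotientMatrix D t₀ t a b := by
  have h := sub_smul_dslope (fun s => D s a b) t₀ t
  simp only [hD0, Matrix.zero_apply, sub_zero, smul_eq_mul] at h
  exact h.symm

lemma quotientMatrix_self (hD : IsJacobiSol K D D') (hD1 : D' t₀ = 1) :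
    quotientMatrix D t₀ t₀ = 1 := by
  ext a b
  simp only [quotientMatrix, Matrix.of_apply, dslope_same]
  rw [(hD.1 t₀ a b).deriv, hD1]

/-- The coefficient of `-w` in `det (X - w P)`. -/
def mixedDet (X P : Matrix (Fin 2) (Fin 2) ℝ) : ℝ :=
  X 0 0 * P 1 1 + P 0 0 * X 1 1 - X 0 1 * P 1 0 - P 0 1 * X 1 0

/-- With `X` the quotient matrix, `P = C - X` and `w` the ratio, `D - iεC = (t - t₀ - iε)(X - wP)`;
the `2 × 2` determinant is then expanded in `w`. -/
lemma det_complexCombination (hD0 : D t₀ = 0) {ε : ℝ} (hε : 0 < ε) (t : ℝ) :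
    (complexCombination ε (C t) (D t)).det = (((t - t₀ : ℝ) : ℂ) - ε * Complex.I) ^ 2 *
      perturbedDet t₀ (fun t => (quotientMatrix D t₀ t).det)
        (fun t => mixedDet (quotientMatrix D t₀ t) (C t - quotientMatrix D t₀ t))
        (fun t => (C t - quotientMatrix D t₀ t).det) ε t := by
  have hw : (((t - t₀ : ℝ) : ℂ) - ε * Complex.I) * ratio t₀ ε t = ε * Complex.I := by
    rw [ratio, mul_div_cancel₀ _ (sub_mul_I_ne_zero hε _)]
  have hX (a b : Fin 2) : (D t a b : ℂ) = ((t - t₀ : ℝ) : ℂ) * (quotientMatrix D t₀ t a b : ℝ) := by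
    rw [sub_mul_quotientMatrix hD0 t a b]
    push_cast
    rfl
  simp only [perturbedDet, mixedDet, Matrix.det_fin_two, Matrix.sub_apply, complexCombination,
    Matrix.smul_apply, Matrix.map_apply, hX, smul_eq_mul]
  generalize ((t - t₀ : ℝ) : ℂ) = τ at *
  generalize ratio t₀ ε t = w at *
  generalize quotientMatrix D t₀ t = X at *
  push_cast
  have hw2 : (τ - ε * Complex.I) ^ 2 * w ^ 2 = (ε * Complex.I) ^ 2 := by rw [← mul_pow, hw]
  linear_combination
    (τ - ε * Complex.I) * ((X 0 0 : ℂ) * (C t 1 1 - X 1 1) + (C t 0 0 - X 0 0) * X 1 1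
      - X 0 1 * (C t 1 0 - X 1 0) - (C t 0 1 - X 0 1) * X 1 0) * hw
    - ((C t 0 0 - X 0 0 : ℂ) * (C t 1 1 - X 1 1) - (C t 0 1 - X 0 1) * (C t 1 0 - X 1 0)) * hw2

/-- The determinant is `1` at `t₀` and never zero, so it is positive by the intermediate value
theorem and attains a positive minimum by compactness. -/
lemma det_quotientMatrix_pos {ℓ : ℝ} (ht₀ : t₀ ∈ Icc 0 ℓ) (hD : IsJacobiSol K D D')
    (hD0 : D t₀ = 0) (hD1 : D' t₀ = 1) (hdet : ∀ t ∈ Icc 0 ℓ, t ≠ t₀ → (D t).det ≠ 0) :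
    ∃ c > 0, ∀ t ∈ Icc 0 ℓ, c ≤ (quotientMatrix D t₀ t).det := by
  have hcont : Continuous fun t => (quotientMatrix D t₀ t).det := by
    simp only [Matrix.det_fin_two]
    have := continuous_quotientMatrix (t₀ := t₀) hD
    exact ((this 0 0).mul (this 1 1)).sub ((this 0 1).mul (this 1 0))
  have h1 : (quotientMatrix D t₀ t₀).det = 1 := by rw [quotientMatrix_self hD hD1, Matrix.det_one]
  have hne : ∀ t ∈ Icc 0 ℓ, (quotientMatrix D t₀ t).det ≠ 0 := by
    intro t ht h0
    by_cases htt : t = t₀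
    · rw [htt, h1] at h0
      exact one_ne_zero h0
    · refine hdet t ht htt ?_
      rw [Matrix.det_fin_two] at h0 ⊢
      simp only [sub_mul_quotientMatrix hD0 t]
      linear_combination (t - t₀) ^ 2 * h0
  have hpos : ∀ t ∈ Icc 0 ℓ, 0 < (quotientMatrix D t₀ t).det := by
    intro t ht
    by_contra hle
    obtain ⟨s, hs, hs0⟩ := intermediate_value_uIcc (a := t) (b := t₀) hcont.continuousOn
      (show (0 : ℝ) ∈ _ from mem_uIcc.2 (Or.inl ⟨not_lt.1 hle, by rw [h1]; exact zero_le_one⟩))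
    exact hne s ((Icc_subset_Icc (le_min ht.1 ht₀.1) (max_le ht.2 ht₀.2)) hs) hs0
  obtain ⟨s, hs, hmin⟩ := isCompact_Icc.exists_isMinOn ⟨t₀, ht₀⟩ hcont.continuousOn
  exact ⟨_, hpos s hs, fun t ht => hmin ht⟩

lemma hasDerivAt_complexCombination_mul {C C' D D' : ℝ → Matrix (Fin 2) (Fin 2) ℝ} {t : ℝ}
    (hC : ∀ a b, HasDerivAt (fun s => C s a b) (C' t a b) t)
    (hD : ∀ a b, HasDerivAt (fun s => D s a b) (D' t a b) t) (ε : ℝ)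
    (N : Matrix (Fin 2) (Fin 2) ℂ) (a b : Fin 2) :
    HasDerivAt (fun s => (complexCombination ε (C s) (D s) * N) a b)
      ((complexCombination ε (C' t) (D' t) * N) a b) t := by
  simp only [Matrix.mul_apply, complexCombination, Matrix.sub_apply, Matrix.smul_apply,
    Matrix.map_apply, smul_eq_mul]
  exact HasDerivAt.fun_sum fun c _ =>
    (((hD a c).ofReal_comp).sub ((hC a c).ofReal_comp.const_mul _)).mul_const _

/-- The complex combination of two real solutions, normalised at `0`, is a solution whose initial
derivative is symmetric with positive definite imaginary part. -/
lemma complexCombination_initial (hK : ∀ t, (K t).IsSymm) (hC : IsJacobiSol K C C')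
    (hD : IsJacobiSol K D D') (hC0 : C t₀ = 1) (hC1 : C' t₀ = 0) (hD0 : D t₀ = 0)
    (hD1 : D' t₀ = 1) {ε : ℝ} (hε : 0 < ε) (hdet : (complexCombination ε (C 0) (D 0)).det ≠ 0) :
    (complexCombination ε (C' 0) (D' 0) * (complexCombination ε (C 0) (D 0))⁻¹).IsSymm ∧
    ((complexCombination ε (C' 0) (D' 0) *
      (complexCombination ε (C 0) (D 0))⁻¹).map Complex.im).PosDef := by
  have hDD := wronskian_eq hK hD hD 0 t₀
  have hCC := wronskian_eq hK hC hC 0 t₀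
  have hCD := wronskian_eq hK hC hD 0 t₀
  have hDC := wronskian_eq hK hD hC 0 t₀
  simp only [hC0, hC1, hD0, hD1, Matrix.transpose_one, Matrix.transpose_zero, mul_zero,
    mul_one, sub_zero, zero_sub] at hDD hCC hCD hDC
  have hDD' : _ = (0 : ℝ) • (1 : Matrix (Fin 2) (Fin 2) ℝ) := hDD.trans (by simp)
  have hCC' : _ = (0 : ℝ) • (1 : Matrix (Fin 2) (Fin 2) ℝ) := hCC.trans (by simp)
  have hCD' : _ = (1 : ℝ) • (1 : Matrix (Fin 2) (Fin 2) ℝ) := hCD.trans (by simp)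
  have hDC' : _ = (-1 : ℝ) • (1 : Matrix (Fin 2) (Fin 2) ℝ) := hDC.trans (by simp)
  have hs := isSymm_mul_inv (isUnit_iff_ne_zero.2 hdet)
    (complexCombination_lagrangian ε hDD' hCC' hCD' hDC')
  exact ⟨hs, posDef_im_mul_inv ε (isUnit_iff_ne_zero.2 hdet) hε hs
    (complexCombination_positive ε hDD' hCC' hCD' hDC')⟩

end Concentration

/-! ### Vanishing of `f ∘ γ` at an interior time. -/

section Main

variable {M : Type*} [TopologicalSpace M] [ChartedSpace (EuclideanHalfSpace 3) M]
  [IsManifold (𝓡∂ 3) ∞ M] {g : Metric M} {ℓ : ℝ} {γ : ℝ → M}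
  {v : (t : ℝ) → TangentSpace (𝓡∂ 3) (γ t)} {e : Fin 2 → (t : ℝ) → TangentSpace (𝓡∂ 3) (γ t)}

lemma isComplexJacobi_complexCombination {K C C' D D' : ℝ → Matrix (Fin 2) (Fin 2) ℝ}
    (hK : ∀ t ∈ Icc 0 ℓ, K t = curvMatrix g γ v e t) (hC : IsJacobiSol K C C')
    (hD : IsJacobiSol K D D') {ε : ℝ} (hdet : (complexCombination ε (C 0) (D 0)).det ≠ 0) :
    IsComplexJacobi g ℓ γ v e
      (complexCombination ε (C' 0) (D' 0) * (complexCombination ε (C 0) (D 0))⁻¹)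
      fun t => complexCombination ε (C t) (D t) * (complexCombination ε (C 0) (D 0))⁻¹ := by
  refine ⟨fun t => complexCombination ε (C' t) (D' t) * (complexCombination ε (C 0) (D 0))⁻¹,
    fun t _ a b => ?_, fun t ht a b => ?_, ?_, rfl⟩
  · exact (hasDerivAt_complexCombination_mul (hC.1 t) (hD.1 t) ε _ a b).hasDerivWithinAt
  · have h := (hasDerivAt_complexCombination_mul (C' := fun t => -(K t * C t))
      (D' := fun t => -(K t * D t)) (hC.2 t) (hD.2 t) ε
      (complexCombination ε (C 0) (D 0))⁻¹ a b).hasDerivWithinAt (s := Icc 0 ℓ)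
    refine h.congr_deriv ?_
    have h2 : complexCombination ε (-(K t * C t)) (-(K t * D t)) =
        -((K t).map ((↑) : ℝ → ℂ) * complexCombination ε (C t) (D t)) := by
      have hneg (A : Matrix (Fin 2) (Fin 2) ℝ) :
          (-A).map ((↑) : ℝ → ℂ) = -A.map ((↑) : ℝ → ℂ) := by ext; simp
      simp only [complexCombination, hneg, map_ofReal_mul, mul_sub, Matrix.mul_smul, smul_neg]
      abel
    rw [h2, ← hK t ht, neg_mul, mul_assoc]
    rfl
  · exact Matrix.mul_nonsing_inv _ (isUnit_iff_ne_zero.2 hdet)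

/-- The curvature matrix, extended to the real line by its boundary values. -/
def extendedCurvMatrix (hℓ : 0 ≤ ℓ) (g : Metric M) (γ : ℝ → M)
    (v : (t : ℝ) → TangentSpace (𝓡∂ 3) (γ t))
    (e : Fin 2 → (t : ℝ) → TangentSpace (𝓡∂ 3) (γ t)) (t : ℝ) : Matrix (Fin 2) (Fin 2) ℝ :=
  curvMatrix g γ v e (projIcc 0 ℓ hℓ t)

lemma extendedCurvMatrix_of_mem (hℓ : 0 ≤ ℓ) {t : ℝ} (ht : t ∈ Icc 0 ℓ) :
    extendedCurvMatrix hℓ g γ v e t = curvMatrix g γ v e t := by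
  rw [extendedCurvMatrix, projIcc_of_mem hℓ ht]

lemma continuous_extendedCurvMatrix (hℓ : 0 ≤ ℓ) (hγ : IsUnitSpeedGeodesic g ℓ γ v)
    (he : IsParallelNormalFrame g ℓ γ v e) : Continuous (extendedCurvMatrix hℓ g γ v e) :=
  continuous_pi fun a => continuous_pi fun b =>
    (continuousOn_curvMatrix hγ he a b).comp_continuous
      (continuous_subtype_val.comp continuous_projIcc) fun t => (projIcc 0 ℓ hℓ t).2

/-- A kernel vector `x` of `D t` gives the Jacobi field with components `D x`, zero at `t₀` and `t`;
its derivative at `t₀` is `x`, which must therefore vanish. -/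
lemma det_ne_zero_of_not_areConjugate (hℓ : 0 < ℓ) (hγ : IsUnitSpeedGeodesic g ℓ γ v)
    (he : IsParallelNormalFrame g ℓ γ v e) {D D' : ℝ → Matrix (Fin 2) (Fin 2) ℝ}
    (hD : IsJacobiSol (extendedCurvMatrix hℓ.le g γ v e) D D') {t₀ t : ℝ} (ht₀ : t₀ ∈ Icc 0 ℓ)
    (hD0 : D t₀ = 0) (hD1 : D' t₀ = 1)
    (hconj : ¬ AreConjugate g ℓ γ v t₀ t) : (D t).det ≠ 0 := by
  intro hdet
  obtain ⟨x, hx, hDx⟩ := Matrix.exists_mulVec_eq_zero_iff.2 hdet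
  refine hx (funext fun a => ?_)
  have key := frame_solution_ne_zero hγ he (t := t) ht₀ hℓ hconj
    (c := fun a s => ∑ b, D s a b * x b) (c' := fun a s => ∑ b, D' s a b * x b)
    (fun s _ a => (HasDerivAt.fun_sum fun b _ => (hD.1 s a b).mul_const (x b)).hasDerivWithinAt)
    (fun s hs a => ?_) (fun a => by simp [hD0]) (fun a => congrFun hDx a) a
  · simpa [hD1, Matrix.one_apply] using key
  · refine (HasDerivAt.fun_sum (u := Finset.univ) fun b _ =>
      (hD.2 s a b).mul_const (x b)).hasDerivWithinAt.congr_deriv ?_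
    rw [extendedCurvMatrix_of_mem hℓ.le hs]
    simp only [Matrix.mul_apply, Fin.sum_univ_two]
    ring

theorem eq_zero_of_rayTransform_eq_zero (hℓ : 0 < ℓ) (hγ : IsUnitSpeedGeodesic g ℓ γ v)
    (he : IsParallelNormalFrame g ℓ γ v e) {t₀ : ℝ} (ht₀ : t₀ ∈ Ioo 0 ℓ)
    (hconj : ∀ t ∈ Icc 0 ℓ, t₀ ≠ t → ¬ AreConjugate g ℓ γ v t₀ t) (m : ℕ) (f : C(M, ℂ))
    (hf : ∀ H₀ : Matrix (Fin 2) (Fin 2) ℂ, H₀.IsSymm → (H₀.map Complex.im).PosDef →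
      ∀ (Y : ℝ → Matrix (Fin 2) (Fin 2) ℂ) (σ : ℝ → ℂ),
        IsComplexJacobi g ℓ γ v e H₀ Y → IsSqrtDet ℓ Y σ → rayTransform ℓ γ m Y σ f = 0) :
    f (γ t₀) = 0 := by
  have ht₀' : t₀ ∈ Icc 0 ℓ := Ioo_subset_Icc_self ht₀
  have hKcont := continuous_extendedCurvMatrix hℓ.le hγ he
  have hKproj (t : ℝ) : extendedCurvMatrix hℓ.le g γ v e t =
      extendedCurvMatrix hℓ.le g γ v e (projIcc 0 ℓ hℓ.le t) := by
    rw [extendedCurvMatrix_of_mem hℓ.le (projIcc 0 ℓ hℓ.le t).2, extendedCurvMatrix]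
  have hKsymm (t : ℝ) : (extendedCurvMatrix hℓ.le g γ v e t).IsSymm :=
    Matrix.IsSymm.ext fun a b => curvMatrix_symm _ _ _
  obtain ⟨C, C', hC, hC0, hC1⟩ := exists_isJacobiSol hKcont hℓ.le hKproj t₀ 1 0
  obtain ⟨D, D', hD, hD0, hD1⟩ := exists_isJacobiSol hKcont hℓ.le hKproj t₀ 0 1
  obtain ⟨c, hc, hdc⟩ := det_quotientMatrix_pos ht₀' hD hD0 hD1 fun t ht hne =>
    det_ne_zero_of_not_areConjugate hℓ hγ he hD ht₀' hD0 hD1 (hconj t ht hne.symm)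
  set d : ℝ → ℝ := fun t => (quotientMatrix D t₀ t).det with hd_def
  set b : ℝ → ℝ := fun t => mixedDet (quotientMatrix D t₀ t) (C t - quotientMatrix D t₀ t)
    with hb_def
  set p : ℝ → ℝ := fun t => (C t - quotientMatrix D t₀ t).det with hp_def
  have hXc (i j : Fin 2) := continuous_quotientMatrix (t₀ := t₀) hD i j
  have hCc (i j : Fin 2) : Continuous fun t => C t i j :=
    continuous_iff_continuousAt.2 fun t => (hC.1 t i j).continuousAt
  have hdcont : Continuous d := by
    simp only [hd_def, Matrix.det_fin_two]
    fun_prop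
  have hbcont : Continuous b := by
    simp only [hb_def, mixedDet, Matrix.sub_apply]
    fun_prop
  have hpcont : Continuous p := by
    simp only [hp_def, Matrix.det_fin_two, Matrix.sub_apply]
    fun_prop
  have hX0 := quotientMatrix_self hD hD1
  have hd0 : d t₀ = 1 := by simp [hd_def, hX0]
  have hb0 : b t₀ = 0 := by simp [hb_def, hX0, hC0, mixedDet]
  have hp0 : p t₀ = 0 := by simp [hp_def, hX0, hC0]
  have hre := eventually_re_perturbedDet (ℓ := ℓ) hbcont hpcont hb0 hp0 hc hdc
  -- The principal square root; it is continuous in `t` for small `ε`, and `√(c/2)` bounds it below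
  -- because the real part of its square is at least `c/2`.
  set r : ℝ → ℝ → ℂ := fun ε t => perturbedDet t₀ d b p ε t ^ (((2 : ℕ) : ℂ)⁻¹) with hr_def
  have hr2 (ε t : ℝ) : r ε t ^ 2 = perturbedDet t₀ d b p ε t :=
    Complex.cpow_nat_inv_pow _ two_ne_zero
  have hFcont : ContinuousOn (fun t => f (γ t)) (Icc 0 ℓ) :=
    f.continuous.comp_continuousOn fun t ht => (hγ.velocity t ht).continuousWithinAt
  have hrcont : ∀ᶠ ε in 𝓝[>] (0 : ℝ), ContinuousOn (r ε) (Icc 0 ℓ) := by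
    filter_upwards [hre, self_mem_nhdsWithin] with ε h hε
    exact (continuous_perturbedDet hdcont hbcont hpcont hε).continuousOn.cpow continuousOn_const
      fun t ht => Or.inl (lt_of_lt_of_le (by positivity) (h t ht))
  have hrc : ∀ᶠ ε in 𝓝[>] (0 : ℝ), ∀ t ∈ Icc 0 ℓ, Real.sqrt (c / 2) ≤ ‖r ε t‖ := by
    filter_upwards [hre] with ε h t ht
    refine Real.sqrt_le_iff.2 ⟨norm_nonneg _, ?_⟩
    rw [← norm_pow, hr2]
    exact (h t ht).trans (Complex.re_le_norm _)
  refine eq_zero_of_concentrating_weights (m := m) (F := fun t => f (γ t)) ht₀ hFcont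
    (Real.sqrt_pos.2 (half_pos hc)) hrcont hrc (fun s => ?_) ?_
  · have h1 : ContinuousAt (fun z : ℂ => z ^ (((2 : ℕ) : ℂ)⁻¹)) 1 :=
      continuousAt_cpow_const (Or.inl (by simp))
    have h2 := h1.tendsto.comp (tendsto_perturbedDet hdcont hbcont hpcont hd0 hb0 hp0 s)
    simpa [Function.comp_def, hr_def] using h2
  · filter_upwards [hrcont, hrc, self_mem_nhdsWithin] with ε hεcont hεc hε
    have hε0 : (0 : ℝ) < ε := hε
    set σ : ℝ → ℂ := fun t => (((t - t₀ : ℝ) : ℂ) - ε * Complex.I) * r ε t with hσ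
    have hσdet (t : ℝ) : (complexCombination ε (C t) (D t)).det = σ t ^ 2 := by
      rw [det_complexCombination hD0 hε0, hσ, mul_pow, hr2]
    have hσ0 : σ 0 ≠ 0 := mul_ne_zero (sub_mul_I_ne_zero hε0 _)
      (norm_pos_iff.1 ((Real.sqrt_pos.2 (half_pos hc)).trans_le (hεc 0 ⟨le_rfl, hℓ.le⟩)))
    have hdet0 : (complexCombination ε (C 0) (D 0)).det ≠ 0 := by
      rw [hσdet]
      exact pow_ne_zero _ hσ0
    have hσcont : ContinuousOn σ (Icc 0 ℓ) := ContinuousOn.mul (by fun_prop) hεcont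
    obtain ⟨hsymm, hpd⟩ := complexCombination_initial hKsymm hC hD hC0 hC1 hD0 hD1 hε0 hdet0
    have hdetY (t : ℝ) : (complexCombination ε (C t) (D t) *
        (complexCombination ε (C 0) (D 0))⁻¹).det = (σ t / σ 0) ^ 2 := by
      rw [Matrix.det_mul, Matrix.det_nonsing_inv, Ring.inverse_eq_inv', hσdet, hσdet, div_pow,
        div_eq_mul_inv]
    have hray := hf _ hsymm hpd _ (fun t => σ t / σ 0)
      (isComplexJacobi_complexCombination (fun t ht => extendedCurvMatrix_of_mem hℓ.le ht)
        hC hD hdet0)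
      ⟨hσcont.div_const _, fun t _ => (hdetY t).symm⟩
    -- Normalising `Y(0) = I` divides `σ` by `σ 0`, which only multiplies the ray transform by this
    -- nonzero constant.
    have hconst : ((‖σ 0 ^ 2‖ : ℝ) : ℂ) * σ 0 ^ m ≠ 0 := mul_ne_zero
      (by exact_mod_cast norm_ne_zero_iff.2 (pow_ne_zero _ hσ0)) (pow_ne_zero _ hσ0)
    have hint (t : ℝ) : f (γ t) *
        ((‖(complexCombination ε (C t) (D t) *
          (complexCombination ε (C 0) (D 0))⁻¹).det‖⁻¹ : ℝ) : ℂ) * ((σ t / σ 0) ^ m)⁻¹ =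
        (((‖σ 0 ^ 2‖ : ℝ) : ℂ) * σ 0 ^ m) *
          (f (γ t) * ((‖σ t ^ 2‖⁻¹ : ℝ) : ℂ) * (σ t ^ m)⁻¹) := by
      rw [hdetY, div_pow, div_pow, norm_div, inv_div, inv_div]
      push_cast
      ring
    rw [rayTransform] at hray
    simp only [hint] at hray
    rw [intervalIntegral.integral_const_mul] at hray
    exact (mul_eq_zero.1 hray).resolve_left hconst

end Main

end RayTransform

end

theorem lemma4p3 {M : Type*} [TopologicalSpace M] [T2Space M] [CompactSpace M]
    [ChartedSpace (EuclideanHalfSpace 3) M] [IsManifold (𝓡∂ 3) ∞ M]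
    (g : RayTransform.Metric M)
    (ℓ : ℝ) (hℓ : 0 < ℓ) (γ : ℝ → M) (v : (t : ℝ) → TangentSpace (𝓡∂ 3) (γ t))
    (hγ : RayTransform.IsUnitSpeedGeodesic g ℓ γ v)
    (hconj : ∀ s ∈ Set.Ioo 0 ℓ, ∀ t ∈ Set.Icc 0 ℓ, s ≠ t →
      ¬ RayTransform.AreConjugate g ℓ γ v s t)
    (e : Fin 2 → (t : ℝ) → TangentSpace (𝓡∂ 3) (γ t))
    (he : RayTransform.IsParallelNormalFrame g ℓ γ v e)
    (m : ℕ) (hm : 1 ≤ m) (f : C(M, ℂ))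
    (hf : ∀ H₀ : Matrix (Fin 2) (Fin 2) ℂ, H₀.IsSymm → (H₀.map Complex.im).PosDef →
      ∀ (Y : ℝ → Matrix (Fin 2) (Fin 2) ℂ) (σ : ℝ → ℂ),
        RayTransform.IsComplexJacobi g ℓ γ v e H₀ Y → RayTransform.IsSqrtDet ℓ Y σ →
        RayTransform.rayTransform ℓ γ m Y σ f = 0) :
    ∀ t ∈ Set.Icc 0 ℓ, f (γ t) = 0 := by
  have hcont : ContinuousOn (fun t => f (γ t)) (Set.Icc 0 ℓ) :=
    f.continuous.comp_continuousOn fun t ht => (hγ.velocity t ht).continuousWithinAt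
  have hinner : Set.EqOn (fun t => f (γ t)) (fun _ => 0) (Set.Ioo 0 ℓ) := fun t ht =>
    RayTransform.eq_zero_of_rayTransform_eq_zero hℓ hγ he ht (hconj t ht) m f hf
  -- The open interval is dense in `[0, ℓ]`, so continuity reaches the endpoints, where no conjugacy
  -- assumption is made.
  exact fun t ht => hinner.of_subset_closure hcont continuousOn_const Set.Ioo_subset_Icc_self
    (closure_Ioo hℓ.ne).ge ht
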